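/- Let $X$, $Y$ and $G$ be locally compact separable metric spaces with their Borel $\sigma$-algebras, let $\mu$ and $\nu$ be $\sigma$-finite measures on $X$ and $Y$, and let $f : X\times Y\to[0,\infty)$ be a probability density with respect to $\mu\times\nu$, with marginal densities $f_X(x)=\int_Y f(x,y)\,\nu(dy)$, $f_Y(y)=\int_X f(x,y)\,\mu(dx)$ and conditional densities $f_{X|Y}(x|y)=f(x,y)/f_Y(y)$, $f_{Y|X}(y|x)=f(x,y)/f_X(x)$. Assume that $$\int_X\int_Y f_{X|Y}(x|y)\,f_{Y|X}(y|x)\,\nu(dy)\,\mu(dx)<\infty .$$ Let $G$ also be a topological group with left Haar measure $\omega_l$, acting continuously on the left of $Y$ by $(g,y)\mapsto gy$, and let $\chi:G\to(0,\infty)$ be a continuous homomorphism such that $\nu$ is relatively left invariant with multiplier $\chi$, i.e. $\chi(g)\int_Y\phi(gy)\,\nu(dy)=\int_Y\phi(y)\,\nu(dy)$ for all $g\in G$ and all $\nu$-integrable $\phi$. Put $m(y)=\int_G f_Y(gy)\chi(g)\,\omega_l(dg)$, and assume that $m(y)>0$ for all $y\in Y$ and $m(y)<\infty$ for $\nu$-almost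 all $y$. Let $R(y,dy')$ be the law of $gy$, where $g$ is drawn from the density $f_Y(gy)\chi(g)/m(y)$ with respect to $\omega_l$. Let $L^2_0(f_X)$ be the Hilbert space of real functions that are square integrable and have mean zero with respect to $f_X\,d\mu$. The data augmentation (DA) operator $K$ and the sandwich operator $K^*$ on $L^2_0(f_X)$ are $(Kh)(x)=\int_X h(x')k(x'|x)\,\mu(dx')$ and $(K^*h)(x)=\int_X h(x')k^*(x'|x)\,\mu(dx')$, where $$k(x'|x)=\int_Y f_{X|Y}(x'|y)f_{Y|X}(y|x)\,\nu(dy),\qquad k^*(x'|x)=\int_Y\int_Y f_{X|Y}(x'|y')\,R(y,dy')\,f_{Y|X}(y|x)\,\nu(dy).$$ Suppose that for some $g\in G$ the equality $f_{X|Y}(x|gy)=f_{X|Y}(x|y)$ fails on a set of positive $\mu\times\nu$-measure of points $(x,y)$ with $f_Y(y)>0$ and $f_Y(gy)>0$. Then $K$ and $K^*$ are well-defined bounded operators on $L^2_0(f_X)$ that are compact, self-adjoint, positive and trace-class. With $\lambda_1\ge\lambda_2\ge\cdots$ and $\lambda_1^*\ge\lambda_2^*\ge\cdots$ denoting their eigenvalues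 repeated according to multiplicity (the positive ones, continued by zeros if there are only finitely many), and with the trace defined as the sum of the eigenvalues, $$\operatorname{tr}(K^*)=\sum_i\lambda_i^*<\sum_i\lambda_i=\operatorname{tr}(K),$$ and hence $\lambda^*_i<\lambda_i$ for at least one $i$. -/

import Mathlib

open MeasureTheory
open scoped ENNReal NNReal

namespace Sandwich

noncomputable section

section Densities

variable {X Y : Type*} [MeasurableSpace X] [MeasurableSpace Y]

/-- The joint function `f` is a probability density with respect to `μ × ν`. -/
structure IsJointDensity (μ : Measure X) (ν : Measure Y) (f : X → Y → ℝ≥0) : Prop where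
  measurable : Measurable (Function.uncurry f)
  lintegral_eq_one : ∫⁻ x, ∫⁻ y, (f x y : ℝ≥0∞) ∂ν ∂μ = 1

/-- The marginal density `f_X`. -/
def margX (ν : Measure Y) (f : X → Y → ℝ≥0) (x : X) : ℝ≥0∞ := ∫⁻ y, (f x y : ℝ≥0∞) ∂ν

/-- The marginal density `f_Y`. -/
def margY (μ : Measure X) (f : X → Y → ℝ≥0) (y : Y) : ℝ≥0∞ := ∫⁻ x, (f x y : ℝ≥0∞) ∂μ

/-- The conditional density `f_{X|Y}(x | y)`; it is only meaningful where `f_Y(y)` is nonzero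
(it is set to `0` elsewhere). -/
def condXY (μ : Measure X) (f : X → Y → ℝ≥0) (x : X) (y : Y) : ℝ≥0∞ :=
  (f x y : ℝ≥0∞) / margY μ f y

/-- The conditional density `f_{Y|X}(y | x)`; it is only meaningful where `f_X(x)` is nonzero
(it is set to `0` elsewhere). -/
def condYX (ν : Measure Y) (f : X → Y → ℝ≥0) (y : Y) (x : X) : ℝ≥0∞ :=
  (f x y : ℝ≥0∞) / margX ν f x

/-- The condition `∫∫ f_{X|Y}(x | y) f_{Y|X}(y | x) ν(dy) μ(dx) < ∞`. -/
def TraceCondition (μ : Measure X) (ν : Measure Y) (f : X → Y → ℝ≥0) : Prop :=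
  ∫⁻ x, ∫⁻ y, condXY μ f x y * condYX ν f y x ∂ν ∂μ < ∞

/-- The transition density `k(x' | x)` of the data augmentation chain. -/
def daDensity (μ : Measure X) (ν : Measure Y) (f : X → Y → ℝ≥0) (x' x : X) : ℝ≥0∞ :=
  ∫⁻ y, condXY μ f x' y * condYX ν f y x ∂ν

/-- The transition density `k*(x' | x)` of the sandwich chain with middle step `R(y, dy')`. -/
def sandwichDensity (μ : Measure X) (ν : Measure Y) (f : X → Y → ℝ≥0) (R : Y → Measure Y)
    (x' x : X) : ℝ≥0∞ :=
  ∫⁻ y, (∫⁻ y', condXY μ f x' y' ∂(R y)) * condYX ν f y x ∂ν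

end Densities

section GroupAction

variable {X Y G : Type*} [MeasurableSpace X] [MeasurableSpace Y]
  [Group G] [TopologicalSpace G] [MeasurableSpace G] [MulAction G Y]

/-- A multiplier: a continuous homomorphism from `G` to the positive reals. -/
structure IsMultiplier (χ : G → ℝ) : Prop where
  continuous : Continuous χ
  pos : ∀ g, 0 < χ g
  map_mul : ∀ g₁ g₂, χ (g₁ * g₂) = χ g₁ * χ g₂

/-- `ν` is relatively left invariant with multiplier `χ`. -/
def IsRelativelyInvariant (ν : Measure Y) (χ : G → ℝ) : Prop :=
  ∀ (g : G) (φ : Y → ℝ), Integrable φ ν →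
    Integrable (fun y => φ (g • y)) ν ∧ χ g * ∫ y, φ (g • y) ∂ν = ∫ y, φ y ∂ν

/-- `m(y) = ∫ f_Y(gy) χ(g) ω(dg)`. -/
def orbitMass (μ : Measure X) (f : X → Y → ℝ≥0) (ω : Measure G) (χ : G → ℝ) (y : Y) : ℝ≥0∞ :=
  ∫⁻ g, margY μ f (g • y) * ENNReal.ofReal (χ g) ∂ω

/-- `R(y, ·)`: the law of `gy`, where `g` is drawn from the density `f_Y(gy) χ(g) / m(y)` with
respect to `ω`. -/
def orbitKernel (μ : Measure X) (f : X → Y → ℝ≥0) (ω : Measure G) (χ : G → ℝ) (y : Y) :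
    Measure Y :=
  (ω.withDensity fun g =>
    margY μ f (g • y) * ENNReal.ofReal (χ g) / orbitMass μ f ω χ y).map fun g => g • y

end GroupAction

section Operators

variable {X : Type*} [MeasurableSpace X]

/-- The space of square integrable functions with mean zero with respect to `π`. (For the
probability measures that occur here, integrability follows from square integrability.) -/
def L20 (π : Measure X) : Submodule ℝ (Lp ℝ 2 π) where
  carrier := {g | Integrable g π ∧ ∫ x, g x ∂π = 0}
  zero_mem' := by
    have h := Lp.coeFn_zero ℝ 2 π
    refine ⟨(integrable_zero X ℝ π).congr h.symm, ?_⟩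
    rw [integral_congr_ae h]
    simp
  add_mem' := by
    rintro a b ⟨ha, ha0⟩ ⟨hb, hb0⟩
    have h := Lp.coeFn_add a b
    refine ⟨(ha.add hb).congr h.symm, ?_⟩
    rw [integral_congr_ae h]
    simp only [Pi.add_apply]
    rw [integral_add ha hb, ha0, hb0, add_zero]
  smul_mem' := by
    rintro c a ⟨ha, ha0⟩
    have h := Lp.coeFn_smul c a
    refine ⟨(ha.smul c).congr h.symm, ?_⟩
    rw [integral_congr_ae h]
    simp only [Pi.smul_apply]
    rw [integral_smul, ha0, smul_zero]

/-- `T` is the operator `(T g)(x) = ∫ g(x') k(x' | x) μ(dx')` on the mean-zero square integrable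
functions of `π`. This determines `T` uniquely. -/
def IsMarkovOperator (μ π : Measure X) (k : X → X → ℝ≥0∞) (T : L20 π →L[ℝ] L20 π) : Prop :=
  ∀ g : L20 π, ∀ᵐ x ∂π,
    Integrable (fun x' => (g : Lp ℝ 2 π) x' * (k x' x).toReal) μ ∧
      (T g : Lp ℝ 2 π) x = ∫ x', (g : Lp ℝ 2 π) x' * (k x' x).toReal ∂μ

/-- `lam 0 ≥ lam 1 ≥ …` is the list of the eigenvalues of the (compact, positive) operator `T` in
decreasing order: each positive eigenvalue is repeated according to its multiplicity, and if there
are only finitely many of them the list is continued by zeros. The sequence is determined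
uniquely. -/
structure IsEigenvalueSeq {E : Type*} [NormedAddCommGroup E] [InnerProductSpace ℝ E]
    (T : E →L[ℝ] E) (lam : ℕ → ℝ) : Prop where
  antitone : Antitone lam
  nonneg : ∀ i, 0 ≤ lam i
  multiplicity : ∀ t : ℝ, 0 < t → {i | lam i = t}.encard =
    Cardinal.toENat (Module.rank ℝ (Module.End.eigenspace (T : E →ₗ[ℝ] E) t))

end Operators

end

end Sandwich

/-!
Write `π = f_X dμ` and `ρ = f_Y dν` for the marginal laws and `q = f / (f_X f_Y)` for the density of
the joint law with respect to `π × ρ`. The trace condition says that `q` is square integrable, so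
`(A h)(y) = ∫ q(x, y) h(x) π(dx)` is a Hilbert–Schmidt operator `L²(π) → L²(ρ)`, and the data
augmentation operator is `K = A† A`.

Averaging over orbits, `(R v)(y) = ∫ v(gy) f_Y(gy) χ(g) ω(dg) / m(y)`, is a symmetric idempotent on
`L²(ρ)`. Symmetry comes from Tonelli's theorem, relative invariance of `ν`, the transformation rule
`m(gy) = Δ(g) χ(g)⁻¹ m(y)` and the fact that `Δ(g) ω(dg)` is the image of `ω` under inversion
(`IsRelativelyInvariant.lintegral_mul_orbitAverage`); it is idempotent because `R v` is constant
along orbits (`orbitAverage_smul`). Hence the sandwich operator `A† R A` equals `A*† A*`, where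
`A* = R A` is the integral operator with kernel `q*(x, ·) = R q(x, ·)`.

Since `R` is an orthogonal projection, `‖A h‖² = ‖A* h‖² + ‖A h - A* h‖²`. The sum of the
eigenvalues of `A† A` is the squared Hilbert–Schmidt norm of `A`, which may be computed in any
orthonormal basis; in a common basis the Pythagorean identity gives `tr K* ≤ tr K`, with equality
only if `A = A*` (`exists_isEigenvalueSeq_lt`). Both operators fix the constants, so equality on the
mean-zero functions forces `q = q*` almost everywhere. Then `f_{X|Y}(x | y)` agrees almost
everywhere with a function that is constant along orbits, which contradicts the assumption on `g`
(`ae_condXY_smul_eq_of_jointRatio_eq`).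

Eigenvalue sequences come from the spectral theorem for compact self-adjoint operators, by sorting
the eigenvalues of an eigenbasis (`decreasingRearrangement`). On the measure side the argument runs
with `ℝ≥0∞`-valued kernels, so that Tonelli's theorem and the algebra of `R` need no integrability.
-/


namespace Sandwich

/-! ### Decreasing rearrangement of a summable family -/

theorem finite_setOf_lt_of_summable {ι : Type*} {a : ι → ℝ} (hs : Summable a) {t : ℝ}
    (ht : 0 < t) : {i | t < a i}.Finite := by
  have h := hs.tendsto_cofinite_zero.eventually (gt_mem_nhds ht)
  rw [Filter.eventually_cofinite] at h
  exact h.subset fun i (hi : t < a i) => not_lt.2 hi.le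

/-- The decreasing rearrangement of a summable nonnegative family, as a sequence: the `n`-th term is
the infimum of the levels `t > 0` that are exceeded by at most `n` members of the family. -/
noncomputable def decreasingRearrangement {ι : Type*} (a : ι → ℝ) (n : ℕ) : ℝ :=
  sInf {t | 0 < t ∧ {i | t < a i}.ncard ≤ n}

section

variable {ι : Type*} {a : ι → ℝ}

theorem decreasingRearrangement_set_nonempty (h0 : ∀ i, 0 ≤ a i) (hs : Summable a) (n : ℕ) :
    {t | 0 < t ∧ {i | t < a i}.ncard ≤ n}.Nonempty := by
  refine ⟨∑' i, a i + 1, add_pos_of_nonneg_of_pos (tsum_nonneg h0) one_pos, ?_⟩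
  have : {i | ∑' i, a i + 1 < a i} = ∅ := by
    ext i
    have := hs.le_tsum i fun j _ => h0 j
    simp only [Set.mem_ofPred_eq, Set.mem_empty_iff_false, iff_false, not_lt]
    linarith
  rw [this]
  simp

theorem decreasingRearrangement_bddBelow (n : ℕ) :
    BddBelow {t | 0 < t ∧ {i | t < a i}.ncard ≤ n} :=
  ⟨0, fun _ ht => ht.1.le⟩

theorem decreasingRearrangement_nonneg (n : ℕ) : 0 ≤ decreasingRearrangement a n :=
  Real.sInf_nonneg fun _ ht => ht.1.le

theorem decreasingRearrangement_antitone (h0 : ∀ i, 0 ≤ a i) (hs : Summable a) :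
    Antitone (decreasingRearrangement a) := fun m n hmn =>
  csInf_le_csInf (decreasingRearrangement_bddBelow n) (decreasingRearrangement_set_nonempty h0 hs m)
    fun _ ht => ⟨ht.1, ht.2.trans hmn⟩

/-- The family and its rearrangement exceed each positive level equally often. -/
theorem lt_decreasingRearrangement_iff (h0 : ∀ i, 0 ≤ a i) (hs : Summable a) {t : ℝ} (ht : 0 < t)
    (n : ℕ) : t < decreasingRearrangement a n ↔ n < {i | t < a i}.ncard := by
  constructor
  · intro h
    by_contra! hn
    exact absurd (csInf_le (decreasingRearrangement_bddBelow n) ⟨ht, hn⟩) (not_le.2 h)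
  · intro hn
    have hfin := finite_setOf_lt_of_summable hs ht
    have hne : {i | t < a i}.Nonempty := Set.nonempty_of_ncard_ne_zero (by omega)
    -- The least member above `t` is still a lower bound of the set defining the rearrangement.
    obtain ⟨i₀, hi₀, hmin⟩ := hfin.exists_minimalFor a _ hne
    refine lt_of_lt_of_le (show t < a i₀ from hi₀)
      (le_csInf (decreasingRearrangement_set_nonempty h0 hs n) ?_)
    rintro s ⟨hs0, hsn⟩
    by_contra! hlt
    have hsub : {i | t < a i} ⊆ {i | s < a i} := fun i hi =>
      hlt.trans_le ((le_total (a i₀) (a i)).elim id fun h => hmin hi h)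
    have := Set.ncard_le_ncard hsub (finite_setOf_lt_of_summable hs hs0)
    omega

/-- Positive values of a summable family are isolated from below. -/
theorem exists_level_below (hs : Summable a) {t : ℝ} (ht : 0 < t) :
    ∃ s, 0 < s ∧ s < t ∧ ∀ i, s < a i → t ≤ a i := by
  have hfin : {i | t / 2 < a i ∧ a i < t}.Finite :=
    (finite_setOf_lt_of_summable hs (half_pos ht)).subset fun i hi => hi.1
  rcases Set.eq_empty_or_nonempty {i | t / 2 < a i ∧ a i < t} with he | hne
  · refine ⟨t / 2, half_pos ht, half_lt_self ht, fun i hi => ?_⟩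
    by_contra! hlt
    exact (Set.mem_empty_iff_false i).1 (he ▸ (⟨hi, hlt⟩ : i ∈ {i | t / 2 < a i ∧ a i < t}))
  · obtain ⟨i₀, hi₀, hmax⟩ := hfin.exists_maximalFor a _ hne
    refine ⟨a i₀, (half_pos ht).trans hi₀.1, hi₀.2, fun i hi => ?_⟩
    by_contra! hlt
    exact absurd (hmax ⟨hi₀.1.trans hi, hlt⟩ hi.le) (not_le.2 hi)

theorem encard_decreasingRearrangement_eq (h0 : ∀ i, 0 ≤ a i) (hs : Summable a) {t : ℝ}
    (ht : 0 < t) : {n | decreasingRearrangement a n = t}.encard = {i | a i = t}.encard := by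
  obtain ⟨s, hs0, hst, hgap⟩ := exists_level_below hs ht
  have hle : ∀ n, s < decreasingRearrangement a n → t ≤ decreasingRearrangement a n := by
    intro n hn
    by_contra! hlt
    set r := decreasingRearrangement a n with hr
    have h1 := (lt_decreasingRearrangement_iff h0 hs hs0 n).1 hn
    have h2 : {i | s < a i} = {i | r < a i} := by
      ext i
      exact ⟨fun hi => hlt.trans_le (hgap i hi), fun hi => hn.trans hi⟩
    rw [h2] at h1
    exact lt_irrefl _ ((lt_decreasingRearrangement_iff h0 hs (hs0.trans hn) n).2 h1)
  have hA : {n | decreasingRearrangement a n = t}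
      = Set.Iio {i | s < a i}.ncard \ Set.Iio {i | t < a i}.ncard := by
    ext n
    simp only [Set.mem_ofPred_eq, Set.mem_sdiff, Set.mem_Iio,
      ← lt_decreasingRearrangement_iff h0 hs hs0, ← lt_decreasingRearrangement_iff h0 hs ht, not_lt]
    exact ⟨fun h => ⟨h ▸ hst, h.le⟩, fun h => le_antisymm h.2 (hle n h.1)⟩
  have hB : {i | a i = t} = {i | s < a i} \ {i | t < a i} := by
    ext i
    simp only [Set.mem_ofPred_eq, Set.mem_sdiff, not_lt]
    exact ⟨fun h => ⟨h ▸ hst, h.le⟩, fun h => le_antisymm h.2 (hgap i h.1)⟩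
  have hsub : {i | t < a i} ⊆ {i | s < a i} := fun i (hi : t < a i) => hst.trans hi
  have hfs := finite_setOf_lt_of_summable hs hs0
  have hft := finite_setOf_lt_of_summable hs ht
  rw [hA, hB, ← (Set.Finite.subset (Set.finite_Iio _) Set.sdiff_subset).cast_ncard_eq,
    ← (hfs.subset Set.sdiff_subset).cast_ncard_eq, Set.ncard_sdiff hsub hft,
    Set.ncard_sdiff (Set.Iio_subset_Iio (Set.ncard_le_ncard hsub hfs)) (Set.finite_Iio _)]
  simp [Set.ncard_eq_toFinset_card']

theorem hasSum_decreasingRearrangement (h0 : ∀ i, 0 ≤ a i) (hs : Summable a) :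
    HasSum (decreasingRearrangement a) (∑' i, a i) := by
  set l := decreasingRearrangement a with hl
  have hfib : ∀ t : ℝ,
      Nonempty ({n : {n // 0 < l n} // l n = t} ≃ {i : {i // 0 < a i} // a i = t}) := by
    intro t
    rcases le_or_gt t 0 with ht | ht
    · have h1 : IsEmpty {n : {n // 0 < l n} // l n = t} :=
        ⟨fun n => absurd n.1.2 (by rw [n.2]; exact not_lt.2 ht)⟩
      have h2 : IsEmpty {i : {i // 0 < a i} // a i = t} :=
        ⟨fun n => absurd n.1.2 (by rw [n.2]; exact not_lt.2 ht)⟩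
      exact ⟨Equiv.equivOfIsEmpty _ _⟩
    · have h := encard_decreasingRearrangement_eq h0 hs ht
      have hfin : {i | a i = t}.Finite :=
        (finite_setOf_lt_of_summable hs (half_pos ht)).subset
          fun i (hi : a i = t) => by rw [Set.mem_ofPred_eq, hi]; exact half_lt_self ht
      have hfin' : {n | l n = t}.Finite := by
        rw [← Set.encard_lt_top_iff, hl, h]
        exact hfin.encard_lt_top
      have := hfin.to_subtype
      have := hfin'.to_subtype
      have hc : Nat.card {n | l n = t} = Nat.card {i | a i = t} := by
        rw [Nat.card_coe_set_eq, Nat.card_coe_set_eq, Set.ncard_def, Set.ncard_def, hl, h]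
      have e1 : {n : {n // 0 < l n} // l n = t} ≃ {n | l n = t} :=
        (Equiv.subtypeSubtypeEquivSubtype (p := fun n => 0 < l n) (q := fun n => l n = t)
          fun h => h ▸ ht)
      have e2 : {i : {i // 0 < a i} // a i = t} ≃ {i | a i = t} :=
        (Equiv.subtypeSubtypeEquivSubtype (p := fun n => 0 < a n) (q := fun n => a n = t)
          fun h => h ▸ ht)
      exact ⟨e1.trans (((Finite.equivFinOfCardEq hc).trans (Finite.equivFin _).symm).trans e2.symm)⟩
  let e : {n // 0 < l n} ≃ {i // 0 < a i} :=
    Equiv.ofFiberEquiv (f := fun n : {n // 0 < l n} => l n) (g := fun i : {i // 0 < a i} => a i)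
      fun t => (hfib t).some
  have he : ∀ n : {n // 0 < l n}, a (e n) = l n := fun n =>
    Equiv.ofFiberEquiv_map (g := fun i : {i // 0 < a i} => a i) _ n
  have h1 : HasSum (fun i : {i // 0 < a i} => a i) (∑' i, a i) :=
    (hasSum_subtype_iff_of_support_subset (s := {i | 0 < a i})
      fun i hi => lt_of_le_of_ne (h0 i) (Ne.symm hi)).2 hs.hasSum
  have h2 := e.hasSum_iff.2 h1
  refine (hasSum_subtype_iff_of_support_subset (s := {n | 0 < l n})
      fun i hi => lt_of_le_of_ne (decreasingRearrangement_nonneg i) (Ne.symm hi)).1 ?_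
  exact h2.congr_fun (by intro n; exact (he n).symm)

end

/-! ### Hilbert–Schmidt operators and their eigenvalues -/

section HilbertSchmidt

universe u v
variable {E : Type u} {F : Type v} [NormedAddCommGroup E] [InnerProductSpace ℝ E]
  [NormedAddCommGroup F] [InnerProductSpace ℝ F]

/-- A bounded operator is Hilbert–Schmidt if `∑ ‖A vᵢ‖² < ∞` for every orthonormal family `v`. -/
def IsHilbertSchmidt (A : E →L[ℝ] F) : Prop :=
  ∀ ⦃ι : Type u⦄ (v : ι → E), Orthonormal ℝ v → Summable fun i => ‖A (v i)‖ ^ 2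

theorem norm_sum_inner_smul_le {ι : Type*} {b : ι → E} (hb : Orthonormal ℝ b) (A : E →L[ℝ] F)
    (s : Finset ι) (x : E) :
    ‖∑ i ∈ s, inner ℝ (b i) x • A (b i)‖ ≤ √(∑ i ∈ s, ‖A (b i)‖ ^ 2) * ‖x‖ := by
  calc ‖∑ i ∈ s, inner ℝ (b i) x • A (b i)‖
      ≤ ∑ i ∈ s, ‖A (b i)‖ * |inner ℝ (b i) x| := by
        refine (norm_sum_le _ _).trans (Finset.sum_le_sum fun i _ => ?_)
        rw [norm_smul, Real.norm_eq_abs, mul_comm]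
    _ ≤ √(∑ i ∈ s, ‖A (b i)‖ ^ 2) * √(∑ i ∈ s, |inner ℝ (b i) x| ^ 2) :=
        Real.sum_mul_le_sqrt_mul_sqrt _ _ _
    _ ≤ √(∑ i ∈ s, ‖A (b i)‖ ^ 2) * ‖x‖ := by
        gcongr
        rw [Real.sqrt_le_left (norm_nonneg _)]
        exact hb.sum_inner_products_le x

/-- A Hilbert–Schmidt operator is the norm limit of the finite partial sums of
`∑ ⟨bᵢ, ·⟩ A bᵢ`. -/
theorem IsHilbertSchmidt.isCompactOperator [CompleteSpace E] [CompleteSpace F] {A : E →L[ℝ] F}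
    (hA : IsHilbertSchmidt A) : IsCompactOperator A := by
  obtain ⟨w, b, -⟩ := exists_hilbertBasis ℝ E
  let R : w → E →L[ℝ] F := fun i => (innerSL ℝ (b i)).smulRight (A (b i))
  have hR : ∀ (s : Finset w) (x : E), (∑ i ∈ s, R i) x = ∑ i ∈ s, inner ℝ (b i) x • A (b i) := by
    intro s x
    simp [R]
  have hsum : Summable R := by
    rw [summable_iff_vanishing_norm]
    intro ε hε
    obtain ⟨s, hs⟩ :=
      summable_iff_vanishing_norm.1 (hA b b.orthonormal) ((ε / 2) ^ 2) (by positivity)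
    refine ⟨s, fun t ht => ?_⟩
    have h1 := hs t ht
    rw [Real.norm_of_nonneg (Finset.sum_nonneg fun i _ => by positivity)] at h1
    refine lt_of_le_of_lt (ContinuousLinearMap.opNorm_le_bound _ (half_pos hε).le fun x => ?_)
      (half_lt_self hε)
    rw [hR]
    refine (norm_sum_inner_smul_le b.orthonormal A t x).trans ?_
    gcongr
    rw [Real.sqrt_le_left (half_pos hε).le]
    exact h1.le
  have hlim : ∑' i, R i = A := by
    ext x
    have h1 : HasSum (fun i => R i x) ((∑' i, R i) x) :=
      hsum.hasSum.mapL (ContinuousLinearMap.apply ℝ F x)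
    have h2 : HasSum (fun i => R i x) (A x) := by
      have := (b.hasSum_repr x).mapL A
      simpa [R, b.repr_apply_apply] using this
    exact h1.unique h2
  have htend : Filter.Tendsto (fun s : Finset w => ∑ i ∈ s, R i) Filter.atTop (nhds A) := by
    have := hsum.hasSum
    rwa [hlim] at this
  refine isCompactOperator_of_tendsto htend (Filter.Eventually.of_forall fun s => ?_)
  refine (compactOperator (RingHom.id ℝ) E F).sum_mem fun i _ => ?_
  have h1 : IsCompactOperator (innerSL ℝ (b i)) :=
    isCompactOperator_of_locallyCompactSpace_dom (innerSL ℝ (b i))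
  exact h1.clm_comp (ContinuousLinearMap.toSpanSingleton ℝ (A (b i)))

theorem ofReal_norm_sq_eq_tsum {ι : Type*} (b : HilbertBasis ι ℝ E) (x : E) :
    ENNReal.ofReal (‖x‖ ^ 2) = ∑' i, ENNReal.ofReal (inner ℝ (b i) x ^ 2) := by
  have h := b.hasSum_inner_mul_inner x x
  have h' : HasSum (fun i => inner ℝ (b i) x ^ 2) (‖x‖ ^ 2) := by
    rw [← real_inner_self_eq_norm_sq]
    exact h.congr_fun fun i => by rw [real_inner_comm x (b i), sq]
  rw [← h'.tsum_eq, ENNReal.ofReal_tsum_of_nonneg (fun i => sq_nonneg _) h'.summable]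

theorem tsum_ofReal_norm_sq_eq_adjoint [CompleteSpace E] [CompleteSpace F] {ι κ : Type*}
    (A : E →L[ℝ] F) (b : HilbertBasis ι ℝ E) (c : HilbertBasis κ ℝ F) :
    ∑' i, ENNReal.ofReal (‖A (b i)‖ ^ 2) =
      ∑' j, ENNReal.ofReal (‖ContinuousLinearMap.adjoint A (c j)‖ ^ 2) := by
  simp_rw [ofReal_norm_sq_eq_tsum c (A _),
    ofReal_norm_sq_eq_tsum b (ContinuousLinearMap.adjoint A _)]
  rw [ENNReal.tsum_comm]
  refine tsum_congr fun j => tsum_congr fun i => ?_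
  rw [ContinuousLinearMap.adjoint_inner_right, real_inner_comm]

/-- The Hilbert–Schmidt norm does not depend on the orthonormal basis. -/
theorem IsHilbertSchmidt.tsum_norm_sq_eq [CompleteSpace E] [CompleteSpace F] {ι κ : Type u}
    {A : E →L[ℝ] F} (hA : IsHilbertSchmidt A) (b : HilbertBasis ι ℝ E) (c : HilbertBasis κ ℝ E) :
    ∑' i, ‖A (b i)‖ ^ 2 = ∑' i, ‖A (c i)‖ ^ 2 := by
  obtain ⟨w, d, -⟩ := exists_hilbertBasis ℝ F
  have h := (tsum_ofReal_norm_sq_eq_adjoint A b d).trans (tsum_ofReal_norm_sq_eq_adjoint A c d).symm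
  rw [← ENNReal.ofReal_tsum_of_nonneg (fun i => by positivity) (hA b b.orthonormal),
    ← ENNReal.ofReal_tsum_of_nonneg (fun i => by positivity) (hA c c.orthonormal)] at h
  exact (ENNReal.ofReal_eq_ofReal_iff (tsum_nonneg fun i => by positivity)
    (tsum_nonneg fun i => by positivity)).1 h

end HilbertSchmidt

section Spectral

universe u
variable {E : Type u} [NormedAddCommGroup E] [InnerProductSpace ℝ E] [CompleteSpace E]

/-- Orthonormal bases of the eigenspaces of a compact self-adjoint operator together form a Hilbert
basis, and a nonzero eigenvalue belongs to as many of its members as its multiplicity says. -/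
theorem exists_eigenbasis {T : E →L[ℝ] E} (hT : IsCompactOperator T)
    (hsymm : (T : E →ₗ[ℝ] E).IsSymmetric) :
    ∃ (ι : Type u) (b : HilbertBasis ι ℝ E) (ev : ι → ℝ), (∀ i, T (b i) = ev i • b i) ∧
      ∀ t : ℝ, t ≠ 0 → {i | ev i = t}.encard =
        Cardinal.toENat (Module.rank ℝ (Module.End.eigenspace (T : E →ₗ[ℝ] E) t)) := by
  have hcl : ∀ t : ℝ, IsClosed (Module.End.eigenspace (T : E →ₗ[ℝ] E) t : Set E) := by
    intro t
    have : (Module.End.eigenspace (T : E →ₗ[ℝ] E) t : Set E) = {x | T x = t • x} := by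
      ext x
      simp
    rw [this]
    exact isClosed_eq T.continuous (continuous_const_smul t)
  have hcomp : ∀ t : ℝ, CompleteSpace (Module.End.eigenspace (T : E →ₗ[ℝ] E) t) := fun t =>
    (hcl t).completeSpace_coe
  choose w c _ using fun t : ℝ => exists_hilbertBasis ℝ (Module.End.eigenspace (T : E →ₗ[ℝ] E) t)
  let v : (Σ t : ℝ, w t) → E := fun a => (c a.1 a.2 : E)
  have hv : Orthonormal ℝ v :=
    hsymm.orthogonalFamily_eigenspaces.orthonormal_sigma_orthonormal fun t => (c t).orthonormal
  have hperp : (Submodule.span ℝ (Set.range v))ᗮ = ⊥ := by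
    rw [eq_bot_iff, ← ContinuousLinearMap.orthogonalComplement_iSup_eigenspaces_eq_bot hT hsymm]
    rw [← Submodule.orthogonal_closure (Submodule.span ℝ (Set.range v))]
    refine Submodule.orthogonal_le (iSup_le fun t x hx => ?_)
    have h1 := ((c t).hasSum_repr ⟨x, hx⟩).mapL (Module.End.eigenspace (T : E →ₗ[ℝ] E) t).subtypeL
    refine (Submodule.isClosed_topologicalClosure _).mem_of_tendsto h1
      (Filter.Eventually.of_forall fun s => ?_)
    refine Submodule.sum_mem _ fun i _ => ?_
    rw [map_smul]
    exact Submodule.smul_mem _ _ (Submodule.le_topologicalClosure _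
      (Submodule.subset_span ⟨⟨t, i⟩, rfl⟩))
  refine ⟨_, HilbertBasis.mkOfOrthogonalEqBot hv hperp, fun a => a.1, fun a => ?_, fun t ht => ?_⟩
  · rw [HilbertBasis.coe_mkOfOrthogonalEqBot]
    exact Module.End.mem_eigenspace_iff.1 (c a.1 a.2).2
  · have := ContinuousLinearMap.finite_dimensional_eigenspace hT t ht
    have hfin : Finite (w t) := (c t).orthonormal.linearIndependent.finite
    have := Fintype.ofFinite (w t)
    rw [rank_eq_card_basis (c t).toOrthonormalBasis.toBasis, Cardinal.toENat_nat,
      ← ENat.card_eq_coe_fintype_card]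
    exact ENat.card_congr (Equiv.sigmaSubtype t)

/-- A positive operator `A†A` with `A` Hilbert–Schmidt has a summable eigenvalue sequence, whose
sum is the squared Hilbert–Schmidt norm of `A` (computed in a suitable basis). -/
theorem exists_isEigenvalueSeq {F : Type*} [NormedAddCommGroup F] [InnerProductSpace ℝ F]
    [CompleteSpace F] {A : E →L[ℝ] F} (hA : IsHilbertSchmidt A) :
    ∃ (lam : ℕ → ℝ) (ι : Type u) (b : HilbertBasis ι ℝ E),
      IsEigenvalueSeq (ContinuousLinearMap.adjoint A ∘L A) lam ∧
      HasSum lam (∑' i, ‖A (b i)‖ ^ 2) := by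
  have hT : IsCompactOperator (ContinuousLinearMap.adjoint A ∘L A) :=
    hA.isCompactOperator.clm_comp (ContinuousLinearMap.adjoint A)
  obtain ⟨ι, b, ev, hev, hmult⟩ :=
    exists_eigenbasis hT (ContinuousLinearMap.isPositive_adjoint_comp_self A).isSymmetric
  have hnorm : ∀ i, ‖A (b i)‖ ^ 2 = ev i := by
    intro i
    rw [← real_inner_self_eq_norm_sq, ← ContinuousLinearMap.adjoint_inner_left]
    have := hev i
    rw [ContinuousLinearMap.comp_apply] at this
    rw [this, real_inner_smul_left, real_inner_self_eq_norm_sq, b.orthonormal.1 i]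
    simp
  have h0 : ∀ i, 0 ≤ ev i := fun i => hnorm i ▸ by positivity
  have hs : Summable ev := (hA b b.orthonormal).congr hnorm
  refine ⟨decreasingRearrangement ev, ι, b, ⟨decreasingRearrangement_antitone h0 hs,
    decreasingRearrangement_nonneg, fun t ht => ?_⟩, ?_⟩
  · rw [encard_decreasingRearrangement_eq h0 hs ht, hmult t ht.ne']
  · simp_rw [hnorm]
    exact hasSum_decreasingRearrangement h0 hs

/-- If `As` is `A` followed by an orthogonal projection, which the Pythagorean identity `hpyth`
expresses, and `A ≠ As`, then the trace of `As† As` is strictly smaller than that of `A† A`. -/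
theorem exists_isEigenvalueSeq_lt {F : Type*} [NormedAddCommGroup F] [InnerProductSpace ℝ F]
    [CompleteSpace F] {A As : E →L[ℝ] F} (hA : IsHilbertSchmidt A) (hAs : IsHilbertSchmidt As)
    (hpyth : ∀ x, ‖A x‖ ^ 2 = ‖As x‖ ^ 2 + ‖A x - As x‖ ^ 2) (hne : A ≠ As) :
    ∃ lam lams : ℕ → ℝ,
      IsEigenvalueSeq (ContinuousLinearMap.adjoint A ∘L A) lam ∧
      IsEigenvalueSeq (ContinuousLinearMap.adjoint As ∘L As) lams ∧
      Summable lam ∧ Summable lams ∧ ∑' i, lams i < ∑' i, lam i ∧ ∃ i, lams i < lam i := by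
  obtain ⟨lam, ι, b, hlam, hsum⟩ := exists_isEigenvalueSeq hA
  obtain ⟨lams, κ, c, hlams, hsums⟩ := exists_isEigenvalueSeq hAs
  have hlt : ∑' i, lams i < ∑' i, lam i := by
    rw [hsum.tsum_eq, hsums.tsum_eq, hA.tsum_norm_sq_eq b c]
    have hle : ∀ i, ‖As (c i)‖ ^ 2 ≤ ‖A (c i)‖ ^ 2 := fun i => by
      rw [hpyth (c i)]
      exact le_add_of_nonneg_right (by positivity)
    obtain ⟨i, hi⟩ : ∃ i, A (c i) ≠ As (c i) := by
      by_contra! h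
      refine hne (ContinuousLinearMap.ext_on (s := Set.range c) ?_ ?_)
      · exact Submodule.dense_iff_topologicalClosure_eq_top.2 c.dense_span
      · rintro _ ⟨i, rfl⟩
        exact h i
    refine Summable.tsum_lt_tsum (i := i) hle ?_ (hAs c c.orthonormal) (hA c c.orthonormal)
    rw [hpyth (c i)]
    have : 0 < ‖A (c i) - As (c i)‖ := norm_pos_iff.2 (sub_ne_zero.2 hi)
    exact lt_add_of_pos_right _ (by positivity)
  refine ⟨lam, lams, hlam, hlams, hsum.summable, hsums.summable, hlt, ?_⟩
  by_contra! h
  exact absurd (hsum.summable.tsum_le_tsum h hsums.summable) (not_le.2 hlt)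

end Spectral

/-! ### Integral operators with square integrable kernels -/

section KernelOperators

variable {X Y : Type*} [MeasurableSpace X] [MeasurableSpace Y]
  {π : Measure X} {ρ : Measure Y}

/-- `A` is the integral operator `L²(π) → L²(ρ)` with kernel `k`, that is
`(A h)(y) = ∫ k(x, y) h(x) π(dx)`. -/
def IsKernelOperator (π : Measure X) (ρ : Measure Y) (k : X → Y → ℝ)
    (A : Lp ℝ 2 π →L[ℝ] Lp ℝ 2 ρ) : Prop :=
  ∀ h : Lp ℝ 2 π, ∀ᵐ y ∂ρ, A h y = ∫ x, k x y * h x ∂π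

theorem integrable_mul_of_memLp_two {f g : X → ℝ} (hf : MemLp f 2 π) (hg : MemLp g 2 π) :
    Integrable (fun x => f x * g x) π := hf.integrable_mul hg

theorem norm_sq_eq_integral_sq (u : Lp ℝ 2 ρ) : ‖u‖ ^ 2 = ∫ y, u y ^ 2 ∂ρ := by
  rw [← real_inner_self_eq_norm_sq, L2.inner_def]
  exact integral_congr_ae (Filter.Eventually.of_forall fun y => by simp [sq])

theorem memLp_two_tensor {h : X → ℝ} {u : Y → ℝ} (hh : MemLp h 2 π) (hu : MemLp u 2 ρ) :
    MemLp (fun z : X × Y => h z.1 * u z.2) 2 (π.prod ρ) := by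
  have hm : AEStronglyMeasurable (fun z : X × Y => h z.1 * u z.2) (π.prod ρ) :=
    hh.1.comp_fst.mul hu.1.comp_snd
  rw [memLp_two_iff_integrable_sq hm]
  simp_rw [mul_pow]
  exact hh.integrable_sq.mul_prod hu.integrable_sq

variable [IsFiniteMeasure π] [IsFiniteMeasure ρ] {k : X → Y → ℝ}

theorem ae_memLp_slice (hk : MemLp (Function.uncurry k) 2 (π.prod ρ)) :
    ∀ᵐ y ∂ρ, MemLp (fun x => k x y) 2 π := by
  filter_upwards [hk.integrable_sq.prod_left_ae, hk.1.prodMk_right] with y h1 h2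
  exact (memLp_two_iff_integrable_sq h2).2 h1

/-- Almost every slice `k(·, y)` represents the functional `h ↦ (A h)(y)`; the exceptional null set
does not depend on `h`. -/
theorem ae_exists_slice (hk : MemLp (Function.uncurry k) 2 (π.prod ρ)) :
    ∀ᵐ y ∂ρ, ∃ S : Lp ℝ 2 π, (∀ h : Lp ℝ 2 π, inner ℝ h S = ∫ x, k x y * h x ∂π) ∧
      ‖S‖ ^ 2 = ∫ x, k x y ^ 2 ∂π := by
  filter_upwards [ae_memLp_slice hk] with y hy
  have hin : ∀ h : Lp ℝ 2 π, inner ℝ h hy.toLp = ∫ x, k x y * h x ∂π := by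
    intro h
    rw [L2.inner_def]
    refine integral_congr_ae ?_
    filter_upwards [hy.coeFn_toLp] with x hx
    rw [hx]
    rfl
  refine ⟨hy.toLp, hin, ?_⟩
  rw [← real_inner_self_eq_norm_sq, hin]
  refine integral_congr_ae ?_
  filter_upwards [hy.coeFn_toLp] with x hx
  rw [hx, sq]

theorem aestronglyMeasurable_kernelIntegral (hk : MemLp (Function.uncurry k) 2 (π.prod ρ))
    (h : Lp ℝ 2 π) : AEStronglyMeasurable (fun y => ∫ x, k x y * h x ∂π) ρ :=
  ((hk.1.mul (Lp.aestronglyMeasurable h).comp_fst).prod_swap).integral_prod_right'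

theorem integrable_integral_sq (hk : MemLp (Function.uncurry k) 2 (π.prod ρ)) :
    Integrable (fun y => ∫ x, k x y ^ 2 ∂π) ρ := hk.integrable_sq.integral_prod_right

theorem ae_sq_kernelIntegral_le (hk : MemLp (Function.uncurry k) 2 (π.prod ρ)) (h : Lp ℝ 2 π) :
    ∀ᵐ y ∂ρ, (∫ x, k x y * h x ∂π) ^ 2 ≤ (∫ x, k x y ^ 2 ∂π) * ‖h‖ ^ 2 := by
  filter_upwards [ae_exists_slice hk] with y ⟨S, hS, hn⟩
  rw [← hS h, ← hn, ← mul_pow, ← sq_abs]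
  have := abs_real_inner_le_norm h S
  rw [mul_comm] at this
  gcongr

theorem memLp_kernelIntegral (hk : MemLp (Function.uncurry k) 2 (π.prod ρ)) (h : Lp ℝ 2 π) :
    MemLp (fun y => ∫ x, k x y * h x ∂π) 2 ρ := by
  have hm := aestronglyMeasurable_kernelIntegral hk h
  rw [memLp_two_iff_integrable_sq hm]
  refine Integrable.mono' ((integrable_integral_sq hk).mul_const (‖h‖ ^ 2)) (hm.pow 2) ?_
  filter_upwards [ae_sq_kernelIntegral_le hk h] with y hy
  rwa [Real.norm_of_nonneg (sq_nonneg _)]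

theorem exists_isKernelOperator (hk : MemLp (Function.uncurry k) 2 (π.prod ρ)) :
    ∃ A : Lp ℝ 2 π →L[ℝ] Lp ℝ 2 ρ, IsKernelOperator π ρ k A := by
  have hsl := ae_memLp_slice hk
  let L : Lp ℝ 2 π →ₗ[ℝ] Lp ℝ 2 ρ :=
    { toFun := fun h => (memLp_kernelIntegral hk h).toLp
      map_add' := by
        intro h h'
        rw [← MemLp.toLp_add]
        refine MemLp.toLp_congr _ _ ?_
        filter_upwards [hsl] with y hy
        simp only [Pi.add_apply]
        rw [← integral_add (integrable_mul_of_memLp_two hy (Lp.memLp h))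
          (integrable_mul_of_memLp_two hy (Lp.memLp h'))]
        refine integral_congr_ae ?_
        filter_upwards [Lp.coeFn_add h h'] with x hx
        rw [hx, Pi.add_apply, mul_add]
      map_smul' := by
        intro c h
        rw [RingHom.id_apply, ← MemLp.toLp_const_smul]
        refine MemLp.toLp_congr _ _ (Filter.Eventually.of_forall fun y => ?_)
        simp only [Pi.smul_apply, smul_eq_mul]
        rw [← integral_const_mul]
        refine integral_congr_ae ?_
        filter_upwards [Lp.coeFn_smul c h] with x hx
        rw [hx, Pi.smul_apply, smul_eq_mul]
        ring }
  refine ⟨L.mkContinuous (√(∫ y, ∫ x, k x y ^ 2 ∂π ∂ρ)) fun h => ?_,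
    fun h => (memLp_kernelIntegral hk h).coeFn_toLp⟩
  rw [← Real.sqrt_sq (norm_nonneg h), ← Real.sqrt_mul' _ (sq_nonneg _)]
  refine Real.le_sqrt_of_sq_le ?_
  rw [norm_sq_eq_integral_sq, ← integral_mul_const]
  have hcoe : ∀ᵐ y ∂ρ, L h y = ∫ x, k x y * h x ∂π := (memLp_kernelIntegral hk h).coeFn_toLp
  refine integral_mono_ae (Lp.memLp (L h)).integrable_sq
    ((integrable_integral_sq hk).mul_const _) ?_
  filter_upwards [hcoe, ae_sq_kernelIntegral_le hk h] with y h1 h2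
  rwa [h1]

/-- Bessel's inequality for the slices of the kernel, integrated. -/
theorem IsKernelOperator.sum_norm_sq_le (hk : MemLp (Function.uncurry k) 2 (π.prod ρ))
    {A : Lp ℝ 2 π →L[ℝ] Lp ℝ 2 ρ} (hA : IsKernelOperator π ρ k A) {ι : Type*} {v : ι → Lp ℝ 2 π}
    (hv : Orthonormal ℝ v) (s : Finset ι) :
    ∑ i ∈ s, ‖A (v i)‖ ^ 2 ≤ ∫ y, ∫ x, k x y ^ 2 ∂π ∂ρ := by
  simp_rw [norm_sq_eq_integral_sq]
  rw [← integral_finsetSum _ fun i _ => (Lp.memLp (A (v i))).integrable_sq]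
  refine integral_mono_ae (integrable_finsetSum _ fun i _ => (Lp.memLp (A (v i))).integrable_sq)
    (integrable_integral_sq hk) ?_
  have hall : ∀ᵐ y ∂ρ, ∀ i ∈ s, A (v i) y = ∫ x, k x y * v i x ∂π :=
    (ae_ball_iff s.countable_toSet).2 fun i _ => hA (v i)
  filter_upwards [ae_exists_slice hk, hall] with y ⟨S, hS, hn⟩ hy
  rw [← hn]
  refine le_trans (Finset.sum_le_sum fun i hi => ?_) (hv.sum_inner_products_le S (s := s))
  rw [hy i hi, ← hS, Real.norm_eq_abs, sq_abs]

theorem IsKernelOperator.summable_norm_sq (hk : MemLp (Function.uncurry k) 2 (π.prod ρ))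
    {A : Lp ℝ 2 π →L[ℝ] Lp ℝ 2 ρ} (hA : IsKernelOperator π ρ k A) {ι : Type*} {v : ι → Lp ℝ 2 π}
    (hv : Orthonormal ℝ v) : Summable fun i => ‖A (v i)‖ ^ 2 :=
  summable_of_sum_le (fun _ => by positivity) fun s => hA.sum_norm_sq_le hk hv s

omit [IsFiniteMeasure π] [IsFiniteMeasure ρ] in
theorem integrable_kernel_mul_tensor (hk : MemLp (Function.uncurry k) 2 (π.prod ρ)) {h : X → ℝ}
    {u : Y → ℝ} (hh : MemLp h 2 π) (hu : MemLp u 2 ρ) :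
    Integrable (fun z : X × Y => k z.1 z.2 * (h z.1 * u z.2)) (π.prod ρ) :=
  hk.integrable_mul (memLp_two_tensor hh hu)

theorem IsKernelOperator.inner_eq {A : Lp ℝ 2 π →L[ℝ] Lp ℝ 2 ρ} (hA : IsKernelOperator π ρ k A)
    (hk : MemLp (Function.uncurry k) 2 (π.prod ρ)) (h : Lp ℝ 2 π) (u : Lp ℝ 2 ρ) :
    inner ℝ (A h) u = ∫ z, k z.1 z.2 * (h z.1 * u z.2) ∂(π.prod ρ) := by
  rw [integral_prod_symm _ (integrable_kernel_mul_tensor hk (Lp.memLp h) (Lp.memLp u)),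
    L2.inner_def]
  refine integral_congr_ae ?_
  filter_upwards [hA h] with y hy
  rw [RCLike.inner_apply, conj_trivial, hy, mul_comm, ← integral_mul_const]
  simp only [mul_assoc]

/-- The adjoint has the transposed kernel. -/
theorem IsKernelOperator.adjoint_ae_eq {A : Lp ℝ 2 π →L[ℝ] Lp ℝ 2 ρ}
    (hA : IsKernelOperator π ρ k A) (hk : MemLp (Function.uncurry k) 2 (π.prod ρ)) :
    IsKernelOperator ρ π (fun y x => k x y) (ContinuousLinearMap.adjoint A) := by
  have hk' : MemLp (Function.uncurry fun y x => k x y) 2 (ρ.prod π) :=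
    hk.comp_measurePreserving Measure.measurePreserving_swap
  obtain ⟨B, hB⟩ := exists_isKernelOperator hk'
  have : ContinuousLinearMap.adjoint A = B := by
    symm
    rw [ContinuousLinearMap.eq_adjoint_iff]
    intro u h
    rw [hB.inner_eq hk', real_inner_comm, hA.inner_eq hk, ← integral_prod_swap]
    exact integral_congr_ae (Filter.Eventually.of_forall fun z => by
      simp only [Prod.fst_swap, Prod.snd_swap]; ring)
  rw [this]
  exact hB

/-- The operator `A† A'` has the kernel `∫ k(x, y) k'(x', y) ρ(dy)`. -/
theorem IsKernelOperator.adjoint_comp_ae_eq {k' : X → Y → ℝ} {A A' : Lp ℝ 2 π →L[ℝ] Lp ℝ 2 ρ}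
    (hA : IsKernelOperator π ρ k A) (hk : MemLp (Function.uncurry k) 2 (π.prod ρ))
    (hA' : IsKernelOperator π ρ k' A') (hk' : MemLp (Function.uncurry k') 2 (π.prod ρ))
    (h : Lp ℝ 2 π) :
    ∀ᵐ x ∂π, Integrable (fun x' => h x' * ∫ y, k x y * k' x' y ∂ρ) π ∧
      ContinuousLinearMap.adjoint A (A' h) x = ∫ x', h x' * ∫ y, k x y * k' x' y ∂ρ ∂π := by
  have hkswap : MemLp (Function.uncurry fun y x => k x y) 2 (ρ.prod π) :=
    hk.comp_measurePreserving Measure.measurePreserving_swap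
  filter_upwards [hA.adjoint_ae_eq hk (A' h), ae_memLp_slice hkswap] with x hx hsl
  have hint : Integrable (fun z : X × Y => k' z.1 z.2 * (h z.1 * k x z.2)) (π.prod ρ) :=
    integrable_kernel_mul_tensor hk' (Lp.memLp h) hsl
  have hrw : ∀ x', ∫ y, k' x' y * (h x' * k x y) ∂ρ = h x' * ∫ y, k x y * k' x' y ∂ρ := by
    intro x'
    rw [← integral_const_mul]
    exact integral_congr_ae (Filter.Eventually.of_forall fun y => by ring)
  refine ⟨hint.integral_prod_left.congr (Filter.Eventually.of_forall hrw), ?_⟩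
  rw [hx]
  calc ∫ y, k x y * A' h y ∂ρ = ∫ y, ∫ x', k' x' y * (h x' * k x y) ∂π ∂ρ := by
        refine integral_congr_ae ?_
        filter_upwards [hA' h] with y hy
        rw [hy, ← integral_const_mul]
        exact integral_congr_ae (Filter.Eventually.of_forall fun x' => by ring)
    _ = ∫ x', ∫ y, k' x' y * (h x' * k x y) ∂ρ ∂π := (integral_integral_swap hint).symm
    _ = _ := by simp_rw [hrw]

end KernelOperators

/-! ### Averaging over the orbits of a group -/

section Multiplier

variable {G : Type*} [TopologicalSpace G] [Group G] {χ : G → ℝ}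

theorem IsMultiplier.map_inv (hχ : IsMultiplier χ) (g : G) : χ g⁻¹ = (χ g)⁻¹ := by
  have h1 : χ 1 = 1 := by
    have := hχ.map_mul 1 1
    rw [mul_one] at this
    exact (mul_eq_left₀ (hχ.pos 1).ne').1 this.symm
  have h2 := hχ.map_mul g⁻¹ g
  rw [inv_mul_cancel, h1] at h2
  exact eq_inv_of_mul_eq_one_left h2.symm

theorem IsMultiplier.measurable_ofReal [MeasurableSpace G] [BorelSpace G] (hχ : IsMultiplier χ) :
    Measurable fun g => ENNReal.ofReal (χ g) :=
  ENNReal.measurable_ofReal.comp hχ.continuous.measurable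

end Multiplier

section OrbitAveraging

variable {X Y G : Type*} [MeasurableSpace X] [MeasurableSpace Y]
  [MetricSpace G] [LocallyCompactSpace G] [SecondCountableTopology G]
  [MeasurableSpace G] [BorelSpace G] [Group G] [IsTopologicalGroup G]
  (ω : Measure G) [ω.IsHaarMeasure]

theorem lintegral_mul_right_eq_modularCharacterFun (F : G → ℝ≥0∞) (hF : Measurable F) (h : G) :
    ∫⁻ g, F (g * h) ∂ω = Measure.modularCharacterFun h * ∫⁻ g, F g ∂ω := by
  rw [← lintegral_map hF (measurable_mul_const h),
    Measure.map_right_mul_eq_modularCharacterFun_smul ω h, lintegral_smul_measure]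
  rfl

/-- Inversion turns the left Haar measure into the right Haar measure `Δ dω`. -/
theorem lintegral_inv_mul_modularCharacterFun (F : G → ℝ≥0∞) (hF : Measurable F) :
    ∫⁻ g, F g⁻¹ * Measure.modularCharacterFun g ∂ω = ∫⁻ g, F g ∂ω := by
  -- A set of positive finite Haar measure.
  obtain ⟨K, hK, hKn⟩ := exists_compact_mem_nhds (1 : G)
  have h0 : ω K ≠ 0 := (Measure.measure_pos_of_mem_nhds ω hKn).ne'
  have htop : ω K ≠ ∞ := hK.measure_lt_top.ne
  have hKm : MeasurableSet K := hK.measurableSet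
  set a : G → ℝ≥0∞ := K.indicator 1 with ha
  have ham : Measurable a := measurable_one.indicator hKm
  have hint : ∫⁻ g, a g ∂ω = ω K := by rw [ha, lintegral_indicator_one hKm]
  -- Both sides, multiplied by `ω K`, are values of the double integral of `a(x) F(y)`.
  have h := lintegral_lintegral_mul_inv ω ω (fun x y => a x * F y)
    ((ham.comp measurable_fst).mul (hF.comp measurable_snd)).aemeasurable
  have hl : ∀ x, ∫⁻ y, a (y * x) * F x⁻¹ ∂ω = F x⁻¹ * Measure.modularCharacterFun x * ω K := by
    intro x
    have hax : Measurable fun y => a (y * x) := ham.comp (measurable_mul_const x)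
    rw [lintegral_mul_const _ hax, lintegral_mul_right_eq_modularCharacterFun ω a ham, hint]
    ring
  have hr : ∀ x, ∫⁻ y, a x * F y ∂ω = a x * ∫⁻ y, F y ∂ω := fun x => lintegral_const_mul _ hF
  simp_rw [hl, hr] at h
  rw [lintegral_mul_const' _ _ htop, lintegral_mul_const _ ham, hint, mul_comm] at h
  exact (ENNReal.mul_right_inj h0 htop).1 h

variable [MulAction G Y]

/-- The unnormalised orbit average `∫ u(gy) χ(g) ω(dg)`. -/
noncomputable def orbitLIntegral (χ : G → ℝ) (u : Y → ℝ≥0∞) (y : Y) : ℝ≥0∞ :=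
  ∫⁻ g, u (g • y) * ENNReal.ofReal (χ g) ∂ω

/-- The average of `v` along the orbit of `y` with weight proportional to `p(gy) χ(g) ω(dg)`. -/
noncomputable def orbitAverage (χ : G → ℝ) (p v : Y → ℝ≥0∞) (y : Y) : ℝ≥0∞ :=
  orbitLIntegral ω χ (fun z => v z * p z) y / orbitLIntegral ω χ p y

variable {χ : G → ℝ}

section

variable [MeasurableSMul₂ G Y]

theorem measurable_orbitLIntegral (hχ : IsMultiplier χ) {U : X → Y → ℝ≥0∞}
    (hU : Measurable (Function.uncurry U)) :
    Measurable (Function.uncurry fun x y => orbitLIntegral ω χ (U x) y) := by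
  refine Measurable.lintegral_prod_right' (f := fun z : (X × Y) × G =>
    U z.1.1 (z.2 • z.1.2) * ENNReal.ofReal (χ z.2)) (Measurable.mul ?_ ?_)
  · exact hU.comp ((measurable_fst.comp measurable_fst).prodMk
      (measurable_snd.smul (measurable_snd.comp measurable_fst)))
  · exact hχ.measurable_ofReal.comp measurable_snd

theorem measurable_orbitLIntegral' (hχ : IsMultiplier χ) {u : Y → ℝ≥0∞} (hu : Measurable u) :
    Measurable (orbitLIntegral ω χ u) :=
  (measurable_orbitLIntegral (X := Unit) (U := fun _ => u) ω hχ (hu.comp measurable_snd)).comp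
    (measurable_prodMk_left (x := ()))

theorem measurable_orbitAverage (hχ : IsMultiplier χ) {p : Y → ℝ≥0∞} (hp : Measurable p)
    {V : X → Y → ℝ≥0∞} (hV : Measurable (Function.uncurry V)) :
    Measurable (Function.uncurry fun x y => orbitAverage ω χ p (V x) y) :=
  (measurable_orbitLIntegral ω hχ (U := fun x z => V x z * p z)
    (hV.mul (hp.comp measurable_snd))).div
    ((measurable_orbitLIntegral' ω hχ hp).comp measurable_snd)

theorem measurable_orbitAverage' (hχ : IsMultiplier χ) {p v : Y → ℝ≥0∞} (hp : Measurable p)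
    (hv : Measurable v) : Measurable (orbitAverage ω χ p v) :=
  (measurable_orbitLIntegral' ω hχ (hv.mul hp)).div (measurable_orbitLIntegral' ω hχ hp)

/-- The transformation rule `m(hy) = Δ(h) χ(h)⁻¹ m(y)`. -/
theorem orbitLIntegral_smul (hχ : IsMultiplier χ) {u : Y → ℝ≥0∞} (hu : Measurable u) (h : G)
    (y : Y) :
    orbitLIntegral ω χ u (h • y) =
      Measure.modularCharacterFun h * ENNReal.ofReal (χ h⁻¹) * orbitLIntegral ω χ u y := by
  have hF : Measurable fun g : G => u (g • y) * ENNReal.ofReal (χ g) :=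
    (hu.comp (measurable_smul_const y)).mul hχ.measurable_ofReal
  unfold orbitLIntegral
  rw [mul_right_comm, ← lintegral_mul_right_eq_modularCharacterFun ω _ hF h,
    ← lintegral_mul_const' _ _ ENNReal.ofReal_ne_top]
  refine lintegral_congr fun g => ?_
  rw [smul_smul, mul_assoc, ← ENNReal.ofReal_mul (hχ.pos _).le, hχ.map_mul, hχ.map_inv,
    mul_inv_cancel_right₀ (hχ.pos h).ne']

omit [SecondCountableTopology G] [MeasurableSpace G] [BorelSpace G] in
theorem modularCharacterFun_mul_ofReal_ne_zero (hχ : IsMultiplier χ) (g h : G) :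
    (Measure.modularCharacterFun g : ℝ≥0∞) * ENNReal.ofReal (χ h) ≠ 0 :=
  mul_ne_zero (ENNReal.coe_ne_zero.2 (Measure.modularCharacterFun_pos g).ne')
    (ENNReal.ofReal_pos.2 (hχ.pos h)).ne'

/-- Orbit averages are constant along orbits. -/
theorem orbitAverage_smul (hχ : IsMultiplier χ) {p v : Y → ℝ≥0∞} (hp : Measurable p)
    (hv : Measurable v) (h : G) (y : Y) :
    orbitAverage ω χ p v (h • y) = orbitAverage ω χ p v y := by
  unfold orbitAverage
  rw [orbitLIntegral_smul ω hχ hp, orbitLIntegral_smul ω hχ (u := fun z => v z * p z) (hv.mul hp),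
    ENNReal.mul_div_mul_left _ _ (modularCharacterFun_mul_ofReal_ne_zero hχ h h⁻¹)
      (ENNReal.mul_ne_top ENNReal.coe_ne_top ENNReal.ofReal_ne_top)]

omit [LocallyCompactSpace G] [SecondCountableTopology G] [IsTopologicalGroup G]
  [ω.IsHaarMeasure] in
theorem orbitAverage_mul_left (hχ : IsMultiplier χ) {p v w : Y → ℝ≥0∞} (hp : Measurable p)
    (hw : Measurable w) (hinv : ∀ (g : G) y, v (g • y) = v y) (y : Y) :
    orbitAverage ω χ p (fun z => v z * w z) y = v y * orbitAverage ω χ p w y := by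
  unfold orbitAverage
  rw [← mul_div_assoc]
  congr 1
  unfold orbitLIntegral
  simp_rw [hinv, mul_assoc]
  exact lintegral_const_mul _ (((hw.comp (measurable_smul_const y))).mul
    ((hp.comp (measurable_smul_const y)).mul hχ.measurable_ofReal))

omit [MeasurableSpace Y] [MetricSpace G] [LocallyCompactSpace G] [SecondCountableTopology G]
  [BorelSpace G] [IsTopologicalGroup G] [ω.IsHaarMeasure] [MeasurableSMul₂ G Y] in
theorem orbitAverage_one {p : Y → ℝ≥0∞} {y : Y} (h0 : orbitLIntegral ω χ p y ≠ 0)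
    (htop : orbitLIntegral ω χ p y ≠ ∞) : orbitAverage ω χ p (fun _ => 1) y = 1 := by
  unfold orbitAverage
  simp only [one_mul]
  exact ENNReal.div_self h0 htop

omit [LocallyCompactSpace G] [SecondCountableTopology G] [IsTopologicalGroup G]
  [ω.IsHaarMeasure] in
theorem orbitAverage_of_invariant (hχ : IsMultiplier χ) {p v : Y → ℝ≥0∞} (hp : Measurable p)
    (hinv : ∀ (g : G) y, v (g • y) = v y) {y : Y} (h0 : orbitLIntegral ω χ p y ≠ 0)
    (htop : orbitLIntegral ω χ p y ≠ ∞) : orbitAverage ω χ p v y = v y := by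
  have := orbitAverage_mul_left ω hχ hp (w := fun _ => 1) measurable_const hinv y
  simpa [orbitAverage_one ω h0 htop] using this

omit [LocallyCompactSpace G] [SecondCountableTopology G] [IsTopologicalGroup G]
  [ω.IsHaarMeasure] in
theorem orbitAverage_const_mul (hχ : IsMultiplier χ) {p v : Y → ℝ≥0∞} (hp : Measurable p)
    (hv : Measurable v) (c : ℝ≥0∞) (y : Y) :
    orbitAverage ω χ p (fun z => c * v z) y = c * orbitAverage ω χ p v y :=
  orbitAverage_mul_left ω hχ hp hv (fun _ _ => rfl) y

omit [LocallyCompactSpace G] [SecondCountableTopology G] [IsTopologicalGroup G]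
  [ω.IsHaarMeasure] in
/-- The Cauchy–Schwarz inequality for the weight `p(gy) χ(g) ω(dg)`, normalised. -/
theorem orbitAverage_sq_le (hχ : IsMultiplier χ) {p v : Y → ℝ≥0∞} (hp : Measurable p)
    (hv : Measurable v) {y : Y} (h0 : orbitLIntegral ω χ p y ≠ 0)
    (htop : orbitLIntegral ω χ p y ≠ ∞) :
    orbitAverage ω χ p v y ^ 2 ≤ orbitAverage ω χ p (fun z => v z ^ 2) y := by
  set m := orbitLIntegral ω χ p y with hm
  set τ : Measure G := ω.withDensity fun g => p (g • y) * ENNReal.ofReal (χ g) with hτ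
  have hwm : Measurable fun g : G => p (g • y) * ENNReal.ofReal (χ g) :=
    (hp.comp (measurable_smul_const y)).mul hχ.measurable_ofReal
  have hform : ∀ u : Y → ℝ≥0∞, Measurable u →
      orbitLIntegral ω χ (fun z => u z * p z) y = ∫⁻ g, u (g • y) ∂τ := by
    intro u hu
    have huy : Measurable fun g : G => u (g • y) := hu.comp (measurable_smul_const y)
    rw [hτ, lintegral_withDensity_eq_lintegral_mul _ hwm huy]
    refine lintegral_congr fun g => ?_
    simp only [Pi.mul_apply]
    ring
  have hτ1 : ∫⁻ _, 1 ∂τ = m := by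
    rw [← hform (fun _ => 1) measurable_const]
    simp [hm]
  have hcs : (∫⁻ g, v (g • y) ∂τ) ^ 2 ≤ (∫⁻ g, v (g • y) ^ 2 ∂τ) * m := by
    have hH := ENNReal.lintegral_mul_le_Lp_mul_Lq τ Real.HolderConjugate.two_two
      (hv.comp (measurable_smul_const y)).aemeasurable (g := fun _ => 1) aemeasurable_const
    simp only [Pi.mul_apply, mul_one, Function.comp_apply, ENNReal.rpow_ofNat, one_pow,
      hτ1] at hH
    calc (∫⁻ g, v (g • y) ∂τ) ^ 2
        ≤ ((∫⁻ g, v (g • y) ^ 2 ∂τ) ^ (1 / 2 : ℝ) * m ^ (1 / 2 : ℝ)) ^ 2 := by gcongr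
      _ = _ := by
        rw [mul_pow, ← ENNReal.rpow_mul_natCast, ← ENNReal.rpow_mul_natCast]
        norm_num
  unfold orbitAverage
  rw [hform v hv, hform (fun z => v z ^ 2) (hv.pow_const 2), ← hm, div_eq_mul_inv, mul_pow,
    div_eq_mul_inv]
  calc (∫⁻ g, v (g • y) ∂τ) ^ 2 * m⁻¹ ^ 2 ≤ (∫⁻ g, v (g • y) ^ 2 ∂τ) * m * m⁻¹ ^ 2 := by gcongr
    _ = (∫⁻ g, v (g • y) ^ 2 ∂τ) * (m * m⁻¹) * m⁻¹ := by ring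
    _ = _ := by rw [ENNReal.mul_inv_cancel h0 htop, mul_one]

end

section RelativelyInvariant

variable [MeasurableSMul₂ G Y] {ν : Measure Y} [SigmaFinite ν]

omit [LocallyCompactSpace G] [SecondCountableTopology G] [BorelSpace G] [IsTopologicalGroup G] in
/-- Relative invariance, stated for integrable functions, as an identity of measures; `σ`-finiteness
reduces it to sets of finite measure. -/
theorem IsRelativelyInvariant.smul_map_eq (hχ : IsMultiplier χ)
    (hν : IsRelativelyInvariant ν χ) (g : G) :
    ENNReal.ofReal (χ g) • ν.map (g • ·) = ν := by
  have key : ∀ s, MeasurableSet s → ν s ≠ ∞ →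
      ENNReal.ofReal (χ g) * ν ((g • ·) ⁻¹' s) = ν s := by
    intro s hs hfin
    have hi : Integrable (s.indicator fun _ => (1 : ℝ)) ν :=
      (integrable_indicator_iff hs).2 (integrableOn_const hfin)
    obtain ⟨h1, h2⟩ := hν g _ hi
    have hpre : (fun y => s.indicator (fun _ => (1 : ℝ)) (g • y)) =
        ((g • ·) ⁻¹' s : Set Y).indicator fun _ => (1 : ℝ) := by
      ext y
      rfl
    have hms : MeasurableSet ((g • ·) ⁻¹' s : Set Y) := measurable_const_smul g hs
    rw [hpre] at h1 h2
    have hfin' : ν ((g • ·) ⁻¹' s) ≠ ∞ := by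
      rw [integrable_indicator_iff hms] at h1
      have := h1.2
      rw [hasFiniteIntegral_iff_enorm] at this
      simpa using this.ne
    rw [integral_indicator_const _ hms, integral_indicator_const _ hs] at h2
    simp only [smul_eq_mul, mul_one] at h2
    rw [← ENNReal.ofReal_toReal hfin, ← ENNReal.ofReal_toReal hfin',
      ← ENNReal.ofReal_mul (hχ.pos g).le]
    exact congrArg ENNReal.ofReal h2
  refine Measure.ext_of_iUnion_eq_univ (iUnion_spanningSets ν) fun i => Measure.ext fun s hs => ?_
  have hsi : MeasurableSet (s ∩ spanningSets ν i) := hs.inter (measurableSet_spanningSets ν i)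
  rw [Measure.restrict_apply hs, Measure.restrict_apply hs, Measure.smul_apply,
    Measure.map_apply (measurable_const_smul g) hsi, smul_eq_mul]
  exact key _ hsi ((measure_mono Set.inter_subset_right).trans_lt
    (measure_spanningSets_lt_top ν i)).ne

omit [LocallyCompactSpace G] [SecondCountableTopology G] [BorelSpace G] [IsTopologicalGroup G] in
theorem IsRelativelyInvariant.lintegral_smul (hχ : IsMultiplier χ)
    (hν : IsRelativelyInvariant ν χ) (g : G) {φ : Y → ℝ≥0∞} (hφ : Measurable φ) :
    ENNReal.ofReal (χ g) * ∫⁻ y, φ (g • y) ∂ν = ∫⁻ y, φ y ∂ν := by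
  conv_rhs => rw [← hν.smul_map_eq hχ g]
  rw [lintegral_smul_measure, lintegral_map hφ (measurable_const_smul g), smul_eq_mul]

omit [LocallyCompactSpace G] [SecondCountableTopology G] [BorelSpace G] [IsTopologicalGroup G] in
theorem IsRelativelyInvariant.quasiMeasurePreserving (hχ : IsMultiplier χ)
    (hν : IsRelativelyInvariant ν χ) (g : G) :
    Measure.QuasiMeasurePreserving (g • · : Y → Y) ν ν := by
  refine ⟨measurable_const_smul g, ?_⟩
  conv_rhs => rw [← hν.smul_map_eq hχ g]
  exact Measure.AbsolutelyContinuous.rfl.smul_right (ENNReal.ofReal_pos.2 (hχ.pos g)).ne'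

/-- After the substitution `y ↦ g⁻¹y`, relative invariance cancels `χ(g)`; what is left is the mirror
image of the integral, because `1 / m(g⁻¹y) = Δ(g) χ(g⁻¹) / m(y)` and `Δ(g) ω(dg)` is the image of
`ω` under inversion. So orbit averaging is a symmetric operation with respect to `p dν`. -/
theorem IsRelativelyInvariant.lintegral_mul_orbitAverage (hχ : IsMultiplier χ)
    (hν : IsRelativelyInvariant ν χ) {p u v : Y → ℝ≥0∞} (hp : Measurable p) (hu : Measurable u)
    (hv : Measurable v) (hpos : ∀ y, orbitLIntegral ω χ p y ≠ 0) :
    ∫⁻ y, u y * orbitAverage ω χ p v y * p y ∂ν = ∫⁻ y, orbitAverage ω χ p u y * v y * p y ∂ν := by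
  set m := orbitLIntegral ω χ p with hm
  have hmm : Measurable m := measurable_orbitLIntegral' ω hχ hp
  have hjoint : Measurable fun z : Y × G => z.2 • z.1 := measurable_snd.smul measurable_fst
  have hjoint' : Measurable fun z : G × Y => z.1⁻¹ • z.2 := measurable_fst.inv.smul measurable_snd
  calc ∫⁻ y, u y * orbitAverage ω χ p v y * p y ∂ν
      = ∫⁻ y, ∫⁻ g, u y * p y / m y * (v (g • y) * p (g • y)) * ENNReal.ofReal (χ g) ∂ω ∂ν := by
        refine lintegral_congr fun y => ?_
        simp_rw [mul_assoc (u y * p y / m y)]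
        rw [lintegral_const_mul]
        · change u y * (orbitLIntegral ω χ (fun z => v z * p z) y / m y) * p y =
            u y * p y / m y * orbitLIntegral ω χ (fun z => v z * p z) y
          simp only [div_eq_mul_inv]
          ring
        · exact ((hv.comp (measurable_smul_const y)).mul (hp.comp (measurable_smul_const y))).mul
            hχ.measurable_ofReal
    _ = ∫⁻ g, ∫⁻ y, u y * p y / m y * (v (g • y) * p (g • y)) * ENNReal.ofReal (χ g) ∂ν ∂ω := by
        refine lintegral_lintegral_swap (Measurable.aemeasurable ?_)
        exact ((((hu.mul hp).div hmm).comp measurable_fst).mul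
          ((hv.mul hp).comp hjoint)).mul (hχ.measurable_ofReal.comp measurable_snd)
    _ = ∫⁻ g, ∫⁻ y, u (g⁻¹ • y) * p (g⁻¹ • y) / m (g⁻¹ • y) * (v y * p y) ∂ν ∂ω := by
        refine lintegral_congr fun g => ?_
        rw [lintegral_mul_const' _ _ ENNReal.ofReal_ne_top, mul_comm,
          ← hν.lintegral_smul hχ g (φ := fun y =>
            u (g⁻¹ • y) * p (g⁻¹ • y) / m (g⁻¹ • y) * (v y * p y))]
        · simp_rw [inv_smul_smul]
        · exact (((hu.mul hp).div hmm).comp (measurable_const_smul g⁻¹)).mul (hv.mul hp)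
    _ = ∫⁻ y, ∫⁻ g, u (g⁻¹ • y) * p (g⁻¹ • y) / m (g⁻¹ • y) * (v y * p y) ∂ω ∂ν := by
        refine lintegral_lintegral_swap (Measurable.aemeasurable ?_)
        exact (((hu.mul hp).div hmm).comp hjoint').mul ((hv.mul hp).comp measurable_snd)
    _ = ∫⁻ y, orbitAverage ω χ p u y * v y * p y ∂ν := by
        refine lintegral_congr fun y => ?_
        have hF : Measurable fun g : G => u (g • y) * p (g • y) * ENNReal.ofReal (χ g) :=
          ((hu.comp (measurable_smul_const y)).mul (hp.comp (measurable_smul_const y))).mul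
            hχ.measurable_ofReal
        have hL : Measurable fun g : G => u (g⁻¹ • y) * p (g⁻¹ • y) / m (g⁻¹ • y) :=
          ((hu.mul hp).div hmm).comp (measurable_inv.smul_const y)
        rw [lintegral_mul_const _ hL, mul_assoc]
        congr 1
        change _ = (∫⁻ g, u (g • y) * p (g • y) * ENNReal.ofReal (χ g) ∂ω) / m y
        rw [← lintegral_inv_mul_modularCharacterFun ω _ hF, div_eq_mul_inv,
          ← lintegral_mul_const' _ _ (ENNReal.inv_ne_top.2 (hpos y))]
        refine lintegral_congr fun g => ?_
        have hm' : (m (g⁻¹ • y))⁻¹ =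
            Measure.modularCharacterFun g * ENNReal.ofReal (χ g⁻¹) * (m y)⁻¹ := by
          have h1 : (Measure.modularCharacterFun g⁻¹ : ℝ≥0∞) *
              Measure.modularCharacterFun g = 1 := by
            rw [← ENNReal.coe_mul, ← Measure.modularCharacterFun_map_mul, inv_mul_cancel,
              Measure.modularCharacterFun_map_one, ENNReal.coe_one]
          have h2 : ENNReal.ofReal (χ g) * ENNReal.ofReal (χ g⁻¹) = 1 := by
            rw [← ENNReal.ofReal_mul (hχ.pos g).le, hχ.map_inv, mul_inv_cancel₀ (hχ.pos g).ne',
              ENNReal.ofReal_one]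
          rw [hm, orbitLIntegral_smul ω hχ hp, inv_inv, ENNReal.mul_inv
            (Or.inl (modularCharacterFun_mul_ofReal_ne_zero hχ _ _))
            (Or.inl (ENNReal.mul_ne_top ENNReal.coe_ne_top ENNReal.ofReal_ne_top))]
          congr 1
          refine (ENNReal.eq_inv_of_mul_eq_one_left ?_).symm
          rw [mul_mul_mul_comm, mul_comm (Measure.modularCharacterFun g : ℝ≥0∞), h1, one_mul,
            mul_comm, h2]
        rw [div_eq_mul_inv, hm']
        ring

end RelativelyInvariant

end OrbitAveraging

/-! ### Comparison of the traces of a Markov operator and its projection -/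

section MeanZero

variable {X : Type*} [MeasurableSpace X] {π : Measure X} [IsProbabilityMeasure π]

theorem inner_const_one (h : Lp ℝ 2 π) : inner ℝ (Lp.const 2 π (1 : ℝ)) h = ∫ x, h x ∂π := by
  rw [L2.inner_def]
  refine integral_congr_ae ?_
  filter_upwards [Lp.coeFn_const (p := 2) (μ := π) (1 : ℝ)] with x hx
  rw [hx]
  simp

theorem mem_L20_iff (h : Lp ℝ 2 π) : h ∈ L20 π ↔ inner ℝ (Lp.const 2 π (1 : ℝ)) h = 0 := by
  rw [inner_const_one]
  exact ⟨fun hh => hh.2, fun hh => ⟨(Lp.memLp h).integrable one_le_two, hh⟩⟩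

instance : CompleteSpace (L20 π) := by
  have hset : (L20 π : Set (Lp ℝ 2 π)) = {h | inner ℝ (Lp.const 2 π (1 : ℝ)) h = 0} := by
    ext h
    exact mem_L20_iff h
  have hcl : IsClosed (L20 π : Set (Lp ℝ 2 π)) := by
    rw [hset]
    exact isClosed_eq (by fun_prop) continuous_const
  exact hcl.completeSpace_coe

theorem inner_const_one_self :
    inner ℝ (Lp.const 2 π (1 : ℝ)) (Lp.const 2 π (1 : ℝ)) = 1 := by
  rw [inner_const_one, integral_congr_ae (Lp.coeFn_const (p := 2) (μ := π) (1 : ℝ))]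
  simp

end MeanZero

section NonnegativeKernels

variable {X Y : Type*} [MeasurableSpace X] [MeasurableSpace Y]
  {π : Measure X} {ρ : Measure Y} [IsProbabilityMeasure ρ] {q q' : X → Y → ℝ≥0∞}

theorem memLp_toReal_kernel (hq : Measurable (Function.uncurry q))
    (hq2 : ∫⁻ x, ∫⁻ y, q x y ^ 2 ∂ρ ∂π ≠ ∞) :
    MemLp (Function.uncurry fun x y => (q x y).toReal) 2 (π.prod ρ) := by
  have hm : Measurable (Function.uncurry fun x y => (q x y).toReal) := hq.ennreal_toReal
  rw [memLp_two_iff_integrable_sq hm.aestronglyMeasurable]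
  rw [lintegral_lintegral (f := fun x y => q x y ^ 2) (hq.pow_const 2).aemeasurable] at hq2
  refine (integrable_toReal_of_lintegral_ne_top (hq.pow_const 2).aemeasurable hq2).congr
    (Filter.Eventually.of_forall fun z => ?_)
  exact ENNReal.toReal_pow _ _

theorem ae_ae_lt_top_kernel (hq : Measurable (Function.uncurry q))
    (hq2 : ∫⁻ x, ∫⁻ y, q x y ^ 2 ∂ρ ∂π ≠ ∞) : ∀ᵐ x ∂π, ∀ᵐ y ∂ρ, q x y < ∞ := by
  rw [lintegral_lintegral (f := fun x y => q x y ^ 2) (hq.pow_const 2).aemeasurable] at hq2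
  filter_upwards [Measure.ae_ae_of_ae_prod (ae_lt_top (hq.pow_const 2) hq2)] with x hx
  filter_upwards [hx] with y hy
  simpa using hy

variable [IsProbabilityMeasure π]

omit [IsProbabilityMeasure π] in
theorem toReal_lintegral_mul_kernel (hq : Measurable (Function.uncurry q))
    (hq2 : ∫⁻ x, ∫⁻ y, q x y ^ 2 ∂ρ ∂π ≠ ∞) (hq' : Measurable (Function.uncurry q'))
    (hq2' : ∫⁻ x, ∫⁻ y, q' x y ^ 2 ∂ρ ∂π ≠ ∞) :
    ∀ᵐ x ∂π, ∀ᵐ x' ∂π, (∫⁻ y, q x y * q' x' y ∂ρ).toReal =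
      ∫ y, (q x y).toReal * (q' x' y).toReal ∂ρ := by
  filter_upwards [ae_ae_lt_top_kernel hq hq2] with x hx
  filter_upwards [ae_ae_lt_top_kernel hq' hq2'] with x' hx'
  rw [← integral_toReal]
  · simp_rw [ENNReal.toReal_mul]
  · exact ((hq.comp measurable_prodMk_left).mul (hq'.comp measurable_prodMk_left)).aemeasurable
  · filter_upwards [hx, hx'] with y h1 h2 using ENNReal.mul_lt_top h1 h2

/-- The operator `A† A'` in terms of the nonnegative kernel `∫ q(x, y) q'(x', y) ρ(dy)`. -/
theorem adjoint_comp_ae_eq_lintegral (hq : Measurable (Function.uncurry q))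
    (hq2 : ∫⁻ x, ∫⁻ y, q x y ^ 2 ∂ρ ∂π ≠ ∞) (hq' : Measurable (Function.uncurry q'))
    (hq2' : ∫⁻ x, ∫⁻ y, q' x y ^ 2 ∂ρ ∂π ≠ ∞) {A A' : Lp ℝ 2 π →L[ℝ] Lp ℝ 2 ρ}
    (hA : IsKernelOperator π ρ (fun x y => (q x y).toReal) A)
    (hA' : IsKernelOperator π ρ (fun x y => (q' x y).toReal) A') (h : Lp ℝ 2 π) :
    ∀ᵐ x ∂π, Integrable (fun x' => h x' * (∫⁻ y, q x y * q' x' y ∂ρ).toReal) π ∧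
      ContinuousLinearMap.adjoint A (A' h) x =
        ∫ x', h x' * (∫⁻ y, q x y * q' x' y ∂ρ).toReal ∂π := by
  filter_upwards [hA.adjoint_comp_ae_eq (memLp_toReal_kernel hq hq2) hA'
    (memLp_toReal_kernel hq' hq2') h, toReal_lintegral_mul_kernel hq hq2 hq' hq2'] with x hx hr
  have he : (fun x' => h x' * ∫ y, (q x y).toReal * (q' x' y).toReal ∂ρ) =ᵐ[π]
      fun x' => h x' * (∫⁻ y, q x y * q' x' y ∂ρ).toReal := by
    filter_upwards [hr] with x' hx'
    rw [hx']
  exact ⟨hx.1.congr he, hx.2.trans (integral_congr_ae he)⟩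

/-- A kernel with unit integrals over `x` maps the constant `1` to itself. -/
theorem IsKernelOperator.apply_const_one {A : Lp ℝ 2 π →L[ℝ] Lp ℝ 2 ρ}
    (hA : IsKernelOperator π ρ (fun x y => (q x y).toReal) A)
    (hq : Measurable (Function.uncurry q)) (h1 : ∀ᵐ y ∂ρ, ∫⁻ x, q x y ∂π = 1) :
    A (Lp.const 2 π 1) = Lp.const 2 ρ 1 := by
  refine Lp.ext ?_
  filter_upwards [hA (Lp.const 2 π 1), h1, Lp.coeFn_const (p := 2) (μ := ρ) (1 : ℝ)] with y hy h1 hc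
  have hqy : Measurable fun x => q x y := hq.comp measurable_prodMk_right
  rw [hy, hc, Function.const_apply]
  calc ∫ x, (q x y).toReal * Lp.const 2 π (1 : ℝ) x ∂π = ∫ x, (q x y).toReal ∂π := by
        refine integral_congr_ae ?_
        filter_upwards [Lp.coeFn_const (p := 2) (μ := π) (1 : ℝ)] with x hx
        rw [hx, Function.const_apply, mul_one]
    _ = 1 := by
      rw [integral_toReal hqy.aemeasurable (ae_lt_top hqy (by rw [h1]; exact ENNReal.one_ne_top)),
        h1, ENNReal.toReal_one]

/-- Kernels with the same integral operator agree almost everywhere: test the operators on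
indicator functions. -/
theorem IsKernelOperator.ae_eq_of_same {A : Lp ℝ 2 π →L[ℝ] Lp ℝ 2 ρ}
    (hA : IsKernelOperator π ρ (fun x y => (q x y).toReal) A)
    (hA' : IsKernelOperator π ρ (fun x y => (q' x y).toReal) A)
    (hq : Measurable (Function.uncurry q)) (hq' : Measurable (Function.uncurry q'))
    (h1 : ∀ᵐ x ∂π, ∫⁻ y, q x y ∂ρ = 1) (h1' : ∀ᵐ x ∂π, ∫⁻ y, q' x y ∂ρ = 1) :
    Function.uncurry q =ᵐ[π.prod ρ] Function.uncurry q' := by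
  have total : ∀ r : X → Y → ℝ≥0∞, Measurable (Function.uncurry r) →
      (∀ᵐ x ∂π, ∫⁻ y, r x y ∂ρ = 1) → ∫⁻ z, Function.uncurry r z ∂(π.prod ρ) ≠ ∞ := by
    intro r hr hr1
    rw [lintegral_prod _ hr.aemeasurable]
    simp only [Function.uncurry_apply_pair]
    rw [lintegral_congr_ae hr1]
    simp
  have fin : ∀ r : X → Y → ℝ≥0∞, Measurable (Function.uncurry r) →
      (∀ᵐ x ∂π, ∫⁻ y, r x y ∂ρ = 1) → ∀ᵐ y ∂ρ, ∫⁻ x, r x y ∂π ≠ ∞ := by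
    intro r hr hr1
    have ht := total r hr hr1
    rw [lintegral_prod_symm' _ hr] at ht
    filter_upwards [ae_lt_top hr.lintegral_prod_left' ht] with y hy using hy.ne
  have slice : ∀ (r : X → Y → ℝ≥0∞), Measurable (Function.uncurry r) →
      IsKernelOperator π ρ (fun x y => (r x y).toReal) A → (∀ᵐ x ∂π, ∫⁻ y, r x y ∂ρ = 1) →
      ∀ s (hs : MeasurableSet s), ∀ᵐ y ∂ρ, ∫⁻ x in s, r x y ∂π =
        ENNReal.ofReal (A (indicatorConstLp 2 hs (measure_ne_top π s) (1 : ℝ)) y) := by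
    intro r hr hrA hr1 s hs
    filter_upwards [hrA (indicatorConstLp 2 hs (measure_ne_top π s) (1 : ℝ)), fin r hr hr1]
      with y hy hfin
    have hry : Measurable fun x => r x y := hr.comp measurable_prodMk_right
    have hfin' : ∫⁻ x in s, r x y ∂π ≠ ∞ :=
      ((setLIntegral_le_lintegral s _).trans_lt hfin.lt_top).ne
    rw [hy, ← ENNReal.ofReal_toReal hfin']
    congr 1
    rw [← integral_toReal hry.aemeasurable (ae_lt_top hry hfin'), ← integral_indicator hs]
    refine integral_congr_ae ?_
    filter_upwards [indicatorConstLp_coeFn (p := 2) (hs := hs) (hμs := measure_ne_top π s)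
      (c := (1 : ℝ))] with x hx
    rw [hx]
    by_cases hxs : x ∈ s <;> simp [hxs]
  have hfinite : IsFiniteMeasure ((π.prod ρ).withDensity (Function.uncurry q)) :=
    isFiniteMeasure_withDensity (total q hq h1)
  refine (withDensity_eq_iff hq.aemeasurable hq'.aemeasurable (total q hq h1)).1
    (Measure.ext_prod fun {s t} hs ht => ?_)
  have rect : ∀ r : X → Y → ℝ≥0∞, Measurable (Function.uncurry r) →
      (π.prod ρ).withDensity (Function.uncurry r) (s ×ˢ t) =
        ∫⁻ y in t, ∫⁻ x in s, r x y ∂π ∂ρ := by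
    intro r hr
    rw [withDensity_apply _ (hs.prod ht), ← Measure.prod_restrict,
      lintegral_prod_symm' _ hr]
    rfl
  rw [rect q hq, rect q' hq']
  refine lintegral_congr_ae (ae_restrict_of_ae ?_)
  filter_upwards [slice q hq hA h1 s hs, slice q' hq' hA' h1' s hs] with y e1 e2
  rw [e1, e2]

omit [IsProbabilityMeasure ρ] in
/-- The adjoint of the restriction of `A` to mean-zero functions is `A†` followed by the projection
onto them, so it agrees with `A†` wherever the latter has mean zero. -/
theorem adjoint_restrict_apply {A : Lp ℝ 2 π →L[ℝ] Lp ℝ 2 ρ} {u : Lp ℝ 2 ρ}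
    (hu : ContinuousLinearMap.adjoint A u ∈ L20 π) :
    ((ContinuousLinearMap.adjoint (A ∘L (L20 π).subtypeL) u : L20 π) : Lp ℝ 2 π) =
      ContinuousLinearMap.adjoint A u := by
  have : ContinuousLinearMap.adjoint (A ∘L (L20 π).subtypeL) u =
      ⟨ContinuousLinearMap.adjoint A u, hu⟩ := by
    refine ext_inner_right ℝ fun w => ?_
    rw [ContinuousLinearMap.adjoint_inner_left, Submodule.coe_inner,
      ContinuousLinearMap.adjoint_inner_left]
    rfl
  rw [this]

theorem adjoint_comp_self_mem_L20 {A : Lp ℝ 2 π →L[ℝ] Lp ℝ 2 ρ}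
    (h1 : A (Lp.const 2 π 1) = Lp.const 2 ρ 1)
    (h1' : ContinuousLinearMap.adjoint A (Lp.const 2 ρ 1) = Lp.const 2 π 1) (h : L20 π) :
    ContinuousLinearMap.adjoint A (A h) ∈ L20 π := by
  rw [mem_L20_iff, ContinuousLinearMap.adjoint_inner_right, h1,
    ← ContinuousLinearMap.adjoint_inner_left, h1']
  exact (mem_L20_iff _).1 h.2

theorem IsKernelOperator.isHilbertSchmidt_restrict {k : X → Y → ℝ}
    {A : Lp ℝ 2 π →L[ℝ] Lp ℝ 2 ρ} (hA : IsKernelOperator π ρ k A)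
    (hk : MemLp (Function.uncurry k) 2 (π.prod ρ)) :
    IsHilbertSchmidt (A ∘L (L20 π).subtypeL) := fun _ _ hv =>
  hA.summable_norm_sq hk (hv.comp_linearIsometry (L20 π).subtypeₗᵢ)

/-- Comparison of a Markov kernel `q` with its projection `q*`. The hypothesis `hproj` says that
`q*(x, ·)` is the image of `q(x, ·)` under an orthogonal projection. -/
theorem exists_operators_of_projected_kernel {qs : X → Y → ℝ≥0∞}
    (hq : Measurable (Function.uncurry q)) (hq2 : ∫⁻ x, ∫⁻ y, q x y ^ 2 ∂ρ ∂π ≠ ∞)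
    (hqs : Measurable (Function.uncurry qs)) (hqs2 : ∫⁻ x, ∫⁻ y, qs x y ^ 2 ∂ρ ∂π ≠ ∞)
    (hqY : ∀ᵐ y ∂ρ, ∫⁻ x, q x y ∂π = 1) (hqX : ∀ᵐ x ∂π, ∫⁻ y, q x y ∂ρ = 1)
    (hqsX : ∀ᵐ x ∂π, ∫⁻ y, qs x y ∂ρ = 1)
    (hproj : ∀ x x', ∫⁻ y, q x y * qs x' y ∂ρ = ∫⁻ y, qs x y * qs x' y ∂ρ)
    (hne : ¬ Function.uncurry q =ᵐ[π.prod ρ] Function.uncurry qs) :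
    ∃ K Ks : L20 π →L[ℝ] L20 π,
      (∀ g : L20 π, ∀ᵐ x ∂π,
        Integrable (fun x' => (g : Lp ℝ 2 π) x' * (∫⁻ y, q x y * q x' y ∂ρ).toReal) π ∧
        (K g : Lp ℝ 2 π) x =
          ∫ x', (g : Lp ℝ 2 π) x' * (∫⁻ y, q x y * q x' y ∂ρ).toReal ∂π) ∧
      (∀ g : L20 π, ∀ᵐ x ∂π,
        Integrable (fun x' => (g : Lp ℝ 2 π) x' * (∫⁻ y, q x y * qs x' y ∂ρ).toReal) π ∧
        (Ks g : Lp ℝ 2 π) x =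
          ∫ x', (g : Lp ℝ 2 π) x' * (∫⁻ y, q x y * qs x' y ∂ρ).toReal ∂π) ∧
      IsCompactOperator K ∧ K.IsPositive ∧ IsCompactOperator Ks ∧ Ks.IsPositive ∧
      ∃ lam lams : ℕ → ℝ, IsEigenvalueSeq K lam ∧ IsEigenvalueSeq Ks lams ∧
        Summable lam ∧ Summable lams ∧ ∑' i, lams i < ∑' i, lam i ∧ ∃ i, lams i < lam i := by
  have hk := memLp_toReal_kernel hq hq2
  have hks := memLp_toReal_kernel hqs hqs2
  obtain ⟨A, hA⟩ := exists_isKernelOperator hk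
  obtain ⟨As, hAs⟩ := exists_isKernelOperator hks
  have hcomp : ∀ h,
      ContinuousLinearMap.adjoint A (As h) = ContinuousLinearMap.adjoint As (As h) := by
    intro h
    refine Lp.ext ?_
    filter_upwards [adjoint_comp_ae_eq_lintegral hq hq2 hqs hqs2 hA hAs h,
      adjoint_comp_ae_eq_lintegral hqs hqs2 hqs hqs2 hAs hAs h] with x hx hx'
    rw [hx.2, hx'.2]
    simp_rw [hproj]
  have hinner : ∀ h, inner ℝ (A h) (As h) = ‖As h‖ ^ 2 := by
    intro h
    rw [← ContinuousLinearMap.adjoint_inner_right, hcomp, ContinuousLinearMap.adjoint_inner_right,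
      real_inner_self_eq_norm_sq]
  have hpyth : ∀ h, ‖A h‖ ^ 2 = ‖As h‖ ^ 2 + ‖A h - As h‖ ^ 2 := by
    intro h
    rw [norm_sub_sq_real, hinner]
    ring
  have hA1 : A (Lp.const 2 π 1) = Lp.const 2 ρ 1 := hA.apply_const_one hq hqY
  have hA1' : ContinuousLinearMap.adjoint A (Lp.const 2 ρ 1) = Lp.const 2 π 1 :=
    IsKernelOperator.apply_const_one (q := fun y x => q x y) (hA.adjoint_ae_eq hk)
      (hq.comp measurable_swap) hqX
  have hAs1' : ContinuousLinearMap.adjoint As (Lp.const 2 ρ 1) = Lp.const 2 π 1 :=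
    IsKernelOperator.apply_const_one (q := fun y x => qs x y) (hAs.adjoint_ae_eq hks)
      (hqs.comp measurable_swap) hqsX
  -- `⟨A* 1, 1⟩ = 1` and `A* 1` is the projection of `A 1 = 1`, so `A* 1 = 1`.
  have hAs1 : As (Lp.const 2 π 1) = Lp.const 2 ρ 1 := by
    have h1 : inner ℝ (As (Lp.const 2 π 1)) (Lp.const 2 ρ (1 : ℝ)) = 1 := by
      rw [← ContinuousLinearMap.adjoint_inner_right, hAs1', inner_const_one_self]
    have h2 := hpyth (Lp.const 2 π 1)
    have h3 := hinner (Lp.const 2 π 1)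
    rw [hA1, real_inner_comm, h1] at h3
    have h4 : ‖Lp.const 2 ρ (1 : ℝ)‖ ^ 2 = 1 := by
      rw [← real_inner_self_eq_norm_sq, inner_const_one_self]
    rw [hA1, h4, ← h3] at h2
    have h5 : ‖Lp.const 2 ρ 1 - As (Lp.const 2 π 1)‖ ^ 2 = 0 := by linarith
    exact (sub_eq_zero.1 (norm_eq_zero.1 (pow_eq_zero_iff two_ne_zero |>.1 h5))).symm
  have hB := hA.isHilbertSchmidt_restrict hk
  have hBs := hAs.isHilbertSchmidt_restrict hks
  refine ⟨ContinuousLinearMap.adjoint (A ∘L (L20 π).subtypeL) ∘L (A ∘L (L20 π).subtypeL),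
    ContinuousLinearMap.adjoint (As ∘L (L20 π).subtypeL) ∘L (As ∘L (L20 π).subtypeL),
    fun g => ?_, fun g => ?_, hB.isCompactOperator.clm_comp (ContinuousLinearMap.adjoint _),
    ContinuousLinearMap.isPositive_adjoint_comp_self _,
    hBs.isCompactOperator.clm_comp (ContinuousLinearMap.adjoint _),
    ContinuousLinearMap.isPositive_adjoint_comp_self _,
    exists_isEigenvalueSeq_lt hB hBs (fun h => hpyth h) fun heq => hne ?_⟩
  · filter_upwards [adjoint_comp_ae_eq_lintegral hq hq2 hq hq2 hA hA g] with x hx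
    refine ⟨hx.1, ?_⟩
    rw [← hx.2]
    exact congrArg (fun u : Lp ℝ 2 π => u x)
      (adjoint_restrict_apply (adjoint_comp_self_mem_L20 hA1 hA1' g))
  · filter_upwards [adjoint_comp_ae_eq_lintegral hq hq2 hqs hqs2 hA hAs g] with x hx
    refine ⟨hx.1, ?_⟩
    rw [← hx.2, hcomp]
    exact congrArg (fun u : Lp ℝ 2 π => u x)
      (adjoint_restrict_apply (adjoint_comp_self_mem_L20 hAs1 hAs1' g))
  · have hAA : A = As := by
      ext1 h
      set c : ℝ := inner ℝ (Lp.const 2 π (1 : ℝ)) h with hc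
      have hmem : h - c • Lp.const 2 π (1 : ℝ) ∈ L20 π := by
        rw [mem_L20_iff, inner_sub_right, inner_smul_right, inner_const_one_self, mul_one, ← hc,
          sub_self]
      have h0 : A (h - c • Lp.const 2 π (1 : ℝ)) = As (h - c • Lp.const 2 π (1 : ℝ)) :=
        DFunLike.congr_fun heq ⟨_, hmem⟩
      rw [map_sub, map_sub, map_smul, map_smul, hA1, hAs1] at h0
      exact sub_left_injective h0
    rw [← hAA] at hAs
    exact hA.ae_eq_of_same hAs hq hqs hqX hqsX

end NonnegativeKernels

/-! ### Joint densities and the orbit-averaged transition density -/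

section Densities

variable {X Y : Type*} [MeasurableSpace X] [MeasurableSpace Y] {μ : Measure X} {ν : Measure Y}
  {f : X → Y → ℝ≥0}

/-- The density of the joint law with respect to the product of its marginals, written as
`f_{X|Y}(x | y) / f_X(x)`. -/
noncomputable def jointRatio (μ : Measure X) (ν : Measure Y) (f : X → Y → ℝ≥0) (x : X) (y : Y) :
    ℝ≥0∞ :=
  condXY μ f x y / margX ν f x

namespace IsJointDensity

theorem measurable_coe (hf : IsJointDensity μ ν f) :
    Measurable (Function.uncurry fun x y => (f x y : ℝ≥0∞)) :=
  hf.measurable.coe_nnreal_ennreal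

theorem lintegral_margX (hf : IsJointDensity μ ν f) : ∫⁻ x, margX ν f x ∂μ = 1 :=
  hf.lintegral_eq_one

variable [SigmaFinite μ] [SigmaFinite ν]

omit [SigmaFinite μ] in
theorem measurable_margX (hf : IsJointDensity μ ν f) : Measurable (margX ν f) :=
  hf.measurable_coe.lintegral_prod_right'

omit [SigmaFinite ν] in
theorem measurable_margY (hf : IsJointDensity μ ν f) : Measurable (margY μ f) :=
  hf.measurable_coe.lintegral_prod_left'

omit [SigmaFinite ν] in
theorem measurable_condXY (hf : IsJointDensity μ ν f) :
    Measurable (Function.uncurry (condXY μ f)) :=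
  hf.measurable_coe.div (hf.measurable_margY.comp measurable_snd)

theorem measurable_jointRatio (hf : IsJointDensity μ ν f) :
    Measurable (Function.uncurry (jointRatio μ ν f)) :=
  hf.measurable_condXY.div (hf.measurable_margX.comp measurable_fst)

theorem lintegral_margY (hf : IsJointDensity μ ν f) : ∫⁻ y, margY μ f y ∂ν = 1 := by
  rw [← hf.lintegral_eq_one]
  exact (lintegral_lintegral_swap hf.measurable_coe.aemeasurable).symm

omit [SigmaFinite μ] [SigmaFinite ν] in
theorem isProbabilityMeasure_margX (hf : IsJointDensity μ ν f) :
    IsProbabilityMeasure (μ.withDensity (margX ν f)) :=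
  ⟨by rw [withDensity_apply _ MeasurableSet.univ, Measure.restrict_univ, hf.lintegral_margX]⟩

theorem isProbabilityMeasure_margY (hf : IsJointDensity μ ν f) :
    IsProbabilityMeasure (ν.withDensity (margY μ f)) :=
  ⟨by rw [withDensity_apply _ MeasurableSet.univ, Measure.restrict_univ, hf.lintegral_margY]⟩

omit [SigmaFinite μ] in
theorem ae_margX_lt_top (hf : IsJointDensity μ ν f) : ∀ᵐ x ∂μ, margX ν f x < ∞ :=
  ae_lt_top hf.measurable_margX (by rw [hf.lintegral_margX]; exact ENNReal.one_ne_top)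

theorem ae_margY_lt_top (hf : IsJointDensity μ ν f) : ∀ᵐ y ∂ν, margY μ f y < ∞ :=
  ae_lt_top hf.measurable_margY (by rw [hf.lintegral_margY]; exact ENNReal.one_ne_top)

omit [SigmaFinite μ] [SigmaFinite ν] in
theorem ae_eq_zero_of_margX_eq_zero (hf : IsJointDensity μ ν f) {x : X} (hx : margX ν f x = 0) :
    ∀ᵐ y ∂ν, f x y = 0 := by
  have hm : Measurable fun y => (f x y : ℝ≥0∞) := hf.measurable_coe.comp measurable_prodMk_left
  filter_upwards [(lintegral_eq_zero_iff hm).1 hx] with y hy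
  simpa using hy

theorem ae_ae_margY_eq_zero_imp (hf : IsJointDensity μ ν f) :
    ∀ᵐ x ∂μ, ∀ᵐ y ∂ν, margY μ f y = 0 → f x y = 0 := by
  have hms : MeasurableSet {z : Y × X | margY μ f z.1 = 0 → f z.2 z.1 = 0} := by
    refine MeasurableSet.imp ?_ ?_
    · exact (hf.measurable_margY.comp measurable_fst) (measurableSet_singleton 0)
    · exact (hf.measurable.comp measurable_swap) (measurableSet_singleton 0)
  have h : ∀ᵐ z ∂(ν.prod μ), margY μ f z.1 = 0 → f z.2 z.1 = 0 := by
    rw [Measure.ae_prod_iff_ae_ae hms]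
    refine Filter.Eventually.of_forall fun y => ?_
    by_cases hy : margY μ f y = 0
    · have hm : Measurable fun x => (f x y : ℝ≥0∞) := hf.measurable_coe.comp measurable_prodMk_right
      filter_upwards [(lintegral_eq_zero_iff hm).1 hy] with x hx _
      simpa using hx
    · exact Filter.Eventually.of_forall fun x h => absurd h hy
  exact Measure.ae_ae_of_ae_prod
    ((Measure.measurePreserving_swap (μ := μ) (ν := ν)).quasiMeasurePreserving.ae h)

omit [SigmaFinite μ] in
theorem ae_ae_margX_mul_jointRatio (hf : IsJointDensity μ ν f) :
    ∀ᵐ x ∂μ, ∀ᵐ y ∂ν, margX ν f x * jointRatio μ ν f x y = condXY μ f x y := by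
  filter_upwards [hf.ae_margX_lt_top] with x hx
  by_cases h0 : margX ν f x = 0
  · filter_upwards [hf.ae_eq_zero_of_margX_eq_zero h0] with y hy
    simp [h0, condXY, hy]
  · exact Filter.Eventually.of_forall fun y => ENNReal.mul_div_cancel h0 hx.ne

theorem ae_ae_jointRatio_mul_margY (hf : IsJointDensity μ ν f) :
    ∀ᵐ x ∂μ, ∀ᵐ y ∂ν, jointRatio μ ν f x y * margY μ f y = condYX ν f y x := by
  filter_upwards [hf.ae_ae_margY_eq_zero_imp] with x hx
  filter_upwards [hx, hf.ae_margY_lt_top] with y hy htop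
  by_cases h0 : margY μ f y = 0
  · simp [h0, condYX, hy h0]
  · simp only [jointRatio, condXY, condYX, div_eq_mul_inv]
    rw [mul_right_comm, mul_assoc (f x y : ℝ≥0∞), ENNReal.inv_mul_cancel h0 htop.ne, mul_one]

omit [SigmaFinite ν] in
theorem lintegral_margY_density (hf : IsJointDensity μ ν f) {v : Y → ℝ≥0∞} (hv : Measurable v) :
    ∫⁻ y, v y ∂(ν.withDensity (margY μ f)) = ∫⁻ y, v y * margY μ f y ∂ν := by
  rw [lintegral_withDensity_eq_lintegral_mul _ hf.measurable_margY hv]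
  exact lintegral_congr fun y => mul_comm _ _

omit [SigmaFinite μ] in
theorem lintegral_margX_density (hf : IsJointDensity μ ν f) {v : X → ℝ≥0∞} (hv : Measurable v) :
    ∫⁻ x, v x ∂(μ.withDensity (margX ν f)) = ∫⁻ x, margX ν f x * v x ∂μ :=
  lintegral_withDensity_eq_lintegral_mul _ hf.measurable_margX hv

theorem ae_lintegral_jointRatio_left (hf : IsJointDensity μ ν f) :
    ∀ᵐ y ∂(ν.withDensity (margY μ f)),
      ∫⁻ x, jointRatio μ ν f x y ∂(μ.withDensity (margX ν f)) = 1 := by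
  have hms : MeasurableSet {z : X × Y | margX ν f z.1 * jointRatio μ ν f z.1 z.2 =
      condXY μ f z.1 z.2} :=
    measurableSet_eq_fun ((hf.measurable_margX.comp measurable_fst).mul hf.measurable_jointRatio)
      hf.measurable_condXY
  have h := (Measure.ae_prod_iff_ae_ae hms).2 hf.ae_ae_margX_mul_jointRatio
  have h' : ∀ᵐ y ∂ν, ∀ᵐ x ∂μ, margX ν f x * jointRatio μ ν f x y = condXY μ f x y :=
    Measure.ae_ae_of_ae_prod
      ((Measure.measurePreserving_swap (μ := ν) (ν := μ)).quasiMeasurePreserving.ae h)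
  rw [ae_withDensity_iff hf.measurable_margY]
  filter_upwards [h', hf.ae_margY_lt_top] with y hy htop h0
  have hqy : Measurable fun x => jointRatio μ ν f x y :=
    hf.measurable_jointRatio.comp measurable_prodMk_right
  rw [hf.lintegral_margX_density hqy,
    lintegral_congr_ae hy]
  simp only [condXY, div_eq_mul_inv]
  have hfy : Measurable fun x => (f x y : ℝ≥0∞) := hf.measurable_coe.comp measurable_prodMk_right
  rw [lintegral_mul_const _ hfy]
  exact ENNReal.mul_inv_cancel h0 htop.ne

theorem ae_lintegral_jointRatio_right (hf : IsJointDensity μ ν f) :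
    ∀ᵐ x ∂(μ.withDensity (margX ν f)),
      ∫⁻ y, jointRatio μ ν f x y ∂(ν.withDensity (margY μ f)) = 1 := by
  rw [ae_withDensity_iff hf.measurable_margX]
  filter_upwards [hf.ae_ae_jointRatio_mul_margY, hf.ae_margX_lt_top] with x hx htop h0
  have hqx : Measurable fun y => jointRatio μ ν f x y :=
    hf.measurable_jointRatio.comp measurable_prodMk_left
  rw [hf.lintegral_margY_density hqx, lintegral_congr_ae hx]
  simp only [condYX, div_eq_mul_inv]
  have hfx : Measurable fun y => (f x y : ℝ≥0∞) := hf.measurable_coe.comp measurable_prodMk_left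
  rw [lintegral_mul_const _ hfx]
  exact ENNReal.mul_inv_cancel h0 htop.ne

/-- The trace condition says that the joint ratio is square integrable. -/
theorem lintegral_jointRatio_sq (hf : IsJointDensity μ ν f) :
    ∫⁻ x, ∫⁻ y, jointRatio μ ν f x y ^ 2 ∂(ν.withDensity (margY μ f)) ∂(μ.withDensity (margX ν f)) =
      ∫⁻ x, ∫⁻ y, condXY μ f x y * condYX ν f y x ∂ν ∂μ := by
  have hm : Measurable (Function.uncurry fun x y => jointRatio μ ν f x y ^ 2) :=
    hf.measurable_jointRatio.pow_const 2
  have := hf.isProbabilityMeasure_margY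
  rw [hf.lintegral_margX_density (v := fun x =>
    ∫⁻ y, jointRatio μ ν f x y ^ 2 ∂(ν.withDensity (margY μ f))) hm.lintegral_prod_right']
  refine lintegral_congr_ae ?_
  filter_upwards [hf.ae_ae_jointRatio_mul_margY, hf.ae_ae_margX_mul_jointRatio] with x h1 h2
  have hmx : Measurable fun y => jointRatio μ ν f x y ^ 2 := hm.comp measurable_prodMk_left
  have hmp : Measurable fun y => jointRatio μ ν f x y ^ 2 * margY μ f y :=
    hmx.mul hf.measurable_margY
  rw [hf.lintegral_margY_density hmx, ← lintegral_const_mul _ hmp]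
  refine lintegral_congr_ae ?_
  filter_upwards [h1, h2] with y h1 h2
  rw [← h1, ← h2]
  ring

/-- The factorisation of a transition density whose middle step turns `condXY` into `w`. -/
theorem ae_ae_lintegral_mul_condYX (hf : IsJointDensity μ ν f) {c w : X → Y → ℝ≥0∞}
    (hc : Measurable (Function.uncurry c)) (hw : Measurable (Function.uncurry w))
    (hcw : ∀ᵐ x' ∂μ, ∀ᵐ y ∂(ν.withDensity (margY μ f)), c x' y = margX ν f x' * w x' y) :
    ∀ᵐ x ∂μ, ∀ᵐ x' ∂μ, ∫⁻ y, c x' y * condYX ν f y x ∂ν =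
      margX ν f x' * ∫⁻ y, jointRatio μ ν f x y * w x' y ∂(ν.withDensity (margY μ f)) := by
  filter_upwards [hf.ae_ae_jointRatio_mul_margY] with x hx
  filter_upwards [hcw] with x' hx'
  have hqx : Measurable fun y => jointRatio μ ν f x y :=
    hf.measurable_jointRatio.comp measurable_prodMk_left
  have hcx : Measurable fun y => c x' y := hc.comp measurable_prodMk_left
  have hwx : Measurable fun y => w x' y := hw.comp measurable_prodMk_left
  have hqw : Measurable fun y => jointRatio μ ν f x y * w x' y := hqx.mul hwx
  rw [← lintegral_const_mul _ hqw]
  calc ∫⁻ y, c x' y * condYX ν f y x ∂ν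
      = ∫⁻ y, c x' y * jointRatio μ ν f x y * margY μ f y ∂ν := by
        refine lintegral_congr_ae ?_
        filter_upwards [hx] with y hy
        rw [← hy, mul_assoc]
    _ = ∫⁻ y, c x' y * jointRatio μ ν f x y ∂(ν.withDensity (margY μ f)) :=
        (hf.lintegral_margY_density (hcx.mul hqx)).symm
    _ = _ := by
        refine lintegral_congr_ae ?_
        filter_upwards [hx'] with y hy
        rw [hy]
        ring

omit [SigmaFinite μ] in
/-- Passing from an integral formula with respect to `f_X dμ` to one with respect to `μ`. -/
theorem isMarkovOperator (hf : IsJointDensity μ ν f) {k κ : X → X → ℝ≥0∞}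
    (hk : ∀ᵐ x ∂μ, ∀ᵐ x' ∂μ, k x' x = margX ν f x' * κ x' x)
    {T : L20 (μ.withDensity (margX ν f)) →L[ℝ] L20 (μ.withDensity (margX ν f))}
    (hT : ∀ g : L20 (μ.withDensity (margX ν f)), ∀ᵐ x ∂(μ.withDensity (margX ν f)),
      Integrable (fun x' => (g : Lp ℝ 2 (μ.withDensity (margX ν f))) x' * (κ x' x).toReal)
        (μ.withDensity (margX ν f)) ∧
      (T g : Lp ℝ 2 (μ.withDensity (margX ν f))) x =
        ∫ x', (g : Lp ℝ 2 (μ.withDensity (margX ν f))) x' * (κ x' x).toReal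
          ∂(μ.withDensity (margX ν f))) :
    IsMarkovOperator μ (μ.withDensity (margX ν f)) k T := by
  intro g
  filter_upwards [hT g, (withDensity_absolutelyContinuous μ (margX ν f)).ae_le hk] with x hx hkx
  rw [integrable_withDensity_iff_integrable_smul' hf.measurable_margX hf.ae_margX_lt_top,
    integral_withDensity_eq_integral_toReal_smul hf.measurable_margX hf.ae_margX_lt_top] at hx
  have he : (fun x' => (margX ν f x').toReal •
      ((g : Lp ℝ 2 (μ.withDensity (margX ν f))) x' * (κ x' x).toReal)) =ᵐ[μ]
      fun x' => (g : Lp ℝ 2 (μ.withDensity (margX ν f))) x' * (k x' x).toReal := by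
    filter_upwards [hkx] with x' hx'
    rw [hx', ENNReal.toReal_mul, smul_eq_mul]
    ring
  exact ⟨hx.1.congr he, hx.2.trans (integral_congr_ae he)⟩

end IsJointDensity

end Densities

section SandwichStep

variable {X Y G : Type*} [MeasurableSpace X] [MeasurableSpace Y]
  [MetricSpace G] [LocallyCompactSpace G] [SecondCountableTopology G]
  [MeasurableSpace G] [BorelSpace G] [Group G] [IsTopologicalGroup G]
  [MulAction G Y] [MeasurableSMul₂ G Y]
  {μ : Measure X} [SigmaFinite μ] {ν : Measure Y} [SigmaFinite ν]
  {ω : Measure G} [ω.IsHaarMeasure] {f : X → Y → ℝ≥0} {χ : G → ℝ}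

omit [SigmaFinite ν] in
omit [LocallyCompactSpace G] [SecondCountableTopology G] [IsTopologicalGroup G]
  [ω.IsHaarMeasure] in
theorem lintegral_orbitKernel (hf : IsJointDensity μ ν f) (hχ : IsMultiplier χ) {v : Y → ℝ≥0∞}
    (hv : Measurable v) (y : Y) :
    ∫⁻ y', v y' ∂(orbitKernel μ f ω χ y) = orbitAverage ω χ (margY μ f) v y := by
  have hw : Measurable fun g : G => margY μ f (g • y) * ENNReal.ofReal (χ g) :=
    (hf.measurable_margY.comp (measurable_smul_const y)).mul hχ.measurable_ofReal
  have hvy : Measurable fun g : G => v (g • y) := hv.comp (measurable_smul_const y)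
  unfold orbitKernel
  rw [lintegral_map hv (measurable_smul_const y),
    lintegral_withDensity_eq_lintegral_mul _ (hw.div_const _) hvy]
  change _ = (∫⁻ g, v (g • y) * margY μ f (g • y) * ENNReal.ofReal (χ g) ∂ω) /
    orbitMass μ f ω χ y
  have hvw : Measurable fun g : G => v (g • y) * margY μ f (g • y) * ENNReal.ofReal (χ g) := by
    simp_rw [mul_assoc]
    exact hvy.mul hw
  rw [div_eq_mul_inv, ← lintegral_mul_const _ hvw]
  refine lintegral_congr fun g => ?_
  simp only [Pi.mul_apply, div_eq_mul_inv]
  ring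

variable (hf : IsJointDensity μ ν f) (hχ : IsMultiplier χ) (hν : IsRelativelyInvariant ν χ)
  (hpos : ∀ y, orbitLIntegral ω χ (margY μ f) y ≠ 0)

include hf hχ hν hpos

theorem lintegral_mul_orbitAverage {u v : Y → ℝ≥0∞} (hu : Measurable u) (hv : Measurable v) :
    ∫⁻ y, u y * orbitAverage ω χ (margY μ f) v y ∂(ν.withDensity (margY μ f)) =
      ∫⁻ y, orbitAverage ω χ (margY μ f) u y * v y ∂(ν.withDensity (margY μ f)) := by
  have hu' : Measurable fun y => orbitAverage ω χ (margY μ f) u y * v y :=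
    (measurable_orbitAverage' ω hχ hf.measurable_margY hu).mul hv
  have hv' : Measurable fun y => u y * orbitAverage ω χ (margY μ f) v y :=
    hu.mul (measurable_orbitAverage' ω hχ hf.measurable_margY hv)
  rw [hf.lintegral_margY_density hu', hf.lintegral_margY_density hv']
  exact hν.lintegral_mul_orbitAverage ω hχ hf.measurable_margY hu hv hpos

variable (hfin : ∀ᵐ y ∂ν, orbitLIntegral ω χ (margY μ f) y < ∞)

include hfin

theorem lintegral_orbitAverage {v : Y → ℝ≥0∞} (hv : Measurable v) :
    ∫⁻ y, orbitAverage ω χ (margY μ f) v y ∂(ν.withDensity (margY μ f)) =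
      ∫⁻ y, v y ∂(ν.withDensity (margY μ f)) := by
  have h := lintegral_mul_orbitAverage hf hχ hν hpos hv (v := fun _ => 1) measurable_const
  simp only [mul_one] at h
  rw [← h]
  refine lintegral_congr_ae ((withDensity_absolutelyContinuous ν (margY μ f)).ae_le ?_)
  filter_upwards [hfin] with y hy
  rw [orbitAverage_one ω (hpos y) hy.ne, mul_one]

/-- Orbit averaging is a symmetric idempotent, hence an orthogonal projection. -/
theorem lintegral_orbitAverage_mul_orbitAverage {u v : Y → ℝ≥0∞} (hu : Measurable u)
    (hv : Measurable v) :
    ∫⁻ y, u y * orbitAverage ω χ (margY μ f) v y ∂(ν.withDensity (margY μ f)) =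
      ∫⁻ y, orbitAverage ω χ (margY μ f) u y * orbitAverage ω χ (margY μ f) v y
        ∂(ν.withDensity (margY μ f)) := by
  rw [← lintegral_mul_orbitAverage hf hχ hν hpos hu
    (measurable_orbitAverage' ω hχ hf.measurable_margY hv)]
  refine lintegral_congr_ae ((withDensity_absolutelyContinuous ν (margY μ f)).ae_le ?_)
  filter_upwards [hfin] with y hy
  rw [orbitAverage_of_invariant ω hχ hf.measurable_margY
    (fun g y => orbitAverage_smul ω hχ hf.measurable_margY hv g y) (hpos y) hy.ne]

/-- On the set where `f_X` vanishes, `jointRatio` carries no information about `condXY`; there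
both sides are zero, because orbit averaging preserves integrals with respect to `f_Y dν`. -/
theorem ae_ae_orbitAverage_condXY :
    ∀ᵐ x ∂μ, ∀ᵐ y ∂(ν.withDensity (margY μ f)),
      orbitAverage ω χ (margY μ f) (condXY μ f x) y =
        margX ν f x * orbitAverage ω χ (margY μ f) (jointRatio μ ν f x) y := by
  filter_upwards [hf.ae_margX_lt_top] with x hx
  have hc : Measurable (condXY μ f x) := hf.measurable_condXY.comp measurable_prodMk_left
  have hq : Measurable (jointRatio μ ν f x) := hf.measurable_jointRatio.comp measurable_prodMk_left
  by_cases h0 : margX ν f x = 0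
  · have hz : ∫⁻ y, orbitAverage ω χ (margY μ f) (condXY μ f x) y
        ∂(ν.withDensity (margY μ f)) = 0 := by
      rw [lintegral_orbitAverage hf hχ hν hpos hfin hc, lintegral_eq_zero_iff hc]
      refine (withDensity_absolutelyContinuous ν (margY μ f)).ae_le ?_
      filter_upwards [hf.ae_eq_zero_of_margX_eq_zero h0] with y hy
      simp [condXY, hy]
    filter_upwards [(lintegral_eq_zero_iff
      (measurable_orbitAverage' ω hχ hf.measurable_margY hc)).1 hz] with y hy
    rw [hy, h0, zero_mul, Pi.zero_apply]
  · refine Filter.Eventually.of_forall fun y => ?_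
    rw [← orbitAverage_const_mul ω hχ hf.measurable_margY hq]
    congr 1
    ext y
    exact (ENNReal.mul_div_cancel h0 hx.ne).symm

theorem lintegral_orbitAverage_sq_le :
    ∫⁻ x, ∫⁻ y, orbitAverage ω χ (margY μ f) (jointRatio μ ν f x) y ^ 2
        ∂(ν.withDensity (margY μ f)) ∂(μ.withDensity (margX ν f)) ≤
      ∫⁻ x, ∫⁻ y, jointRatio μ ν f x y ^ 2 ∂(ν.withDensity (margY μ f))
        ∂(μ.withDensity (margX ν f)) := by
  refine lintegral_mono fun x => ?_
  have hq : Measurable (jointRatio μ ν f x) := hf.measurable_jointRatio.comp measurable_prodMk_left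
  refine le_trans (lintegral_mono_ae
    ((withDensity_absolutelyContinuous ν (margY μ f)).ae_le ?_))
    (lintegral_orbitAverage hf hχ hν hpos hfin (hq.pow_const 2)).le
  filter_upwards [hfin] with y hy
  exact orbitAverage_sq_le ω hχ hf.measurable_margY hq (hpos y) hy.ne

/-- If orbit averaging does not change the joint ratio, then `condXY` is a.e. equal to a function
that is constant along orbits. -/
theorem ae_condXY_smul_eq_of_jointRatio_eq
    (heq : Function.uncurry (jointRatio μ ν f)
      =ᵐ[(μ.withDensity (margX ν f)).prod (ν.withDensity (margY μ f))]
      Function.uncurry fun x y => orbitAverage ω χ (margY μ f) (jointRatio μ ν f x) y) (g : G) :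
    ∀ᵐ p ∂(μ.prod ν), margY μ f p.2 ≠ 0 → margY μ f (g • p.2) ≠ 0 →
      condXY μ f p.1 p.2 = condXY μ f p.1 (g • p.2) := by
  have := hf.isProbabilityMeasure_margY
  have hsm : Measurable fun p : X × Y => g • p.2 := (measurable_const_smul g).comp measurable_snd
  rw [Measure.ae_prod_iff_ae_ae]
  · have h1 := Measure.ae_ae_of_ae_prod heq
    rw [ae_withDensity_iff hf.measurable_margX] at h1
    filter_upwards [h1, hf.ae_ae_margX_mul_jointRatio,
      ae_ae_orbitAverage_condXY hf hχ hν hpos hfin] with x h1 h2 h3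
    have hc : Measurable (condXY μ f x) := hf.measurable_condXY.comp measurable_prodMk_left
    rw [ae_withDensity_iff hf.measurable_margY] at h3
    have key : ∀ᵐ y ∂ν, margY μ f y ≠ 0 →
        condXY μ f x y = orbitAverage ω χ (margY μ f) (condXY μ f x) y := by
      by_cases h0 : margX ν f x = 0
      · filter_upwards [h2, h3] with y h2 h3 hy
        rw [← h2, h3 hy, h0, zero_mul, zero_mul]
      · have h1' := h1 h0
        rw [ae_withDensity_iff hf.measurable_margY] at h1'
        filter_upwards [h1', h2, h3] with y h1 h2 h3 hy
        have h4 : jointRatio μ ν f x y =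
            orbitAverage ω χ (margY μ f) (jointRatio μ ν f x) y := h1 hy
        rw [← h2, h3 hy, ← h4]
    filter_upwards [key, (hν.quasiMeasurePreserving hχ g).ae key] with y hy hgy hp hgp
    rw [hy hp, hgy hgp, orbitAverage_smul ω hχ hf.measurable_margY hc]
  · refine MeasurableSet.imp ?_ (MeasurableSet.imp ?_ ?_)
    · exact (hf.measurable_margY.comp measurable_snd) (measurableSet_singleton 0).compl
    · exact (hf.measurable_margY.comp hsm) (measurableSet_singleton 0).compl
    · exact measurableSet_eq_fun hf.measurable_condXY
        (hf.measurable_condXY.comp (measurable_fst.prodMk hsm))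

end SandwichStep

end Sandwich

theorem theorem2 {X Y G : Type*}
    [MetricSpace X] [LocallyCompactSpace X] [TopologicalSpace.SeparableSpace X]
    [MeasurableSpace X] [BorelSpace X]
    [MetricSpace Y] [LocallyCompactSpace Y] [TopologicalSpace.SeparableSpace Y]
    [MeasurableSpace Y] [BorelSpace Y]
    [MetricSpace G] [LocallyCompactSpace G] [TopologicalSpace.SeparableSpace G]
    [MeasurableSpace G] [BorelSpace G]
    [Group G] [IsTopologicalGroup G] [MulAction G Y] [ContinuousSMul G Y]
    (μ : Measure X) [SigmaFinite μ] (ν : Measure Y) [SigmaFinite ν]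
    (ω : Measure G) [ω.IsHaarMeasure]
    (f : X → Y → ℝ≥0) (hf : Sandwich.IsJointDensity μ ν f)
    (htr : Sandwich.TraceCondition μ ν f)
    (χ : G → ℝ) (hχ : Sandwich.IsMultiplier χ) (hν : Sandwich.IsRelativelyInvariant ν χ)
    (hm_pos : ∀ y, 0 < Sandwich.orbitMass μ f ω χ y)
    (hm_fin : ∀ᵐ y ∂ν, Sandwich.orbitMass μ f ω χ y < ∞)
    (hne : ∃ g : G, ¬ ∀ᵐ p ∂(μ.prod ν),
      Sandwich.margY μ f p.2 ≠ 0 → Sandwich.margY μ f (g • p.2) ≠ 0 →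
        Sandwich.condXY μ f p.1 p.2 = Sandwich.condXY μ f p.1 (g • p.2)) :
    ∃ K Ks : Sandwich.L20 (μ.withDensity (Sandwich.margX ν f)) →L[ℝ]
        Sandwich.L20 (μ.withDensity (Sandwich.margX ν f)),
      Sandwich.IsMarkovOperator μ _ (Sandwich.daDensity μ ν f) K ∧
      Sandwich.IsMarkovOperator μ _
        (Sandwich.sandwichDensity μ ν f (Sandwich.orbitKernel μ f ω χ)) Ks ∧
      IsCompactOperator K ∧ K.IsPositive ∧ IsCompactOperator Ks ∧ Ks.IsPositive ∧
      ∃ lam lams : ℕ → ℝ,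
        Sandwich.IsEigenvalueSeq K lam ∧ Sandwich.IsEigenvalueSeq Ks lams ∧
        Summable lam ∧ Summable lams ∧
        ∑' i, lams i < ∑' i, lam i ∧
        ∃ i, lams i < lam i := by
  have hsY : SecondCountableTopology Y := UniformSpace.secondCountable_of_separable Y
  have hsG : SecondCountableTopology G := UniformSpace.secondCountable_of_separable G
  have hpos : ∀ y, Sandwich.orbitLIntegral ω χ (Sandwich.margY μ f) y ≠ 0 := fun y => (hm_pos y).ne'
  have hfin : ∀ᵐ y ∂ν, Sandwich.orbitLIntegral ω χ (Sandwich.margY μ f) y < ∞ := hm_fin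
  have hπ := hf.isProbabilityMeasure_margX
  have hρ := hf.isProbabilityMeasure_margY
  have hq := hf.measurable_jointRatio
  have hqs := Sandwich.measurable_orbitAverage ω hχ hf.measurable_margY hq
  have hRc := Sandwich.measurable_orbitAverage ω hχ hf.measurable_margY hf.measurable_condXY
  have hqx : ∀ x, Measurable (Sandwich.jointRatio μ ν f x) := fun x =>
    hq.comp measurable_prodMk_left
  have hq2 : ∫⁻ x, ∫⁻ y, Sandwich.jointRatio μ ν f x y ^ 2
      ∂(ν.withDensity (Sandwich.margY μ f)) ∂(μ.withDensity (Sandwich.margX ν f)) ≠ ∞ := by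
    rw [hf.lintegral_jointRatio_sq]
    exact htr.ne
  obtain ⟨K, Ks, hK, hKs, h⟩ := Sandwich.exists_operators_of_projected_kernel hq hq2 hqs
    ((Sandwich.lintegral_orbitAverage_sq_le hf hχ hν hpos hfin).trans_lt hq2.lt_top).ne
    hf.ae_lintegral_jointRatio_left hf.ae_lintegral_jointRatio_right
    (by
      filter_upwards [hf.ae_lintegral_jointRatio_right] with x hx
      rw [Sandwich.lintegral_orbitAverage hf hχ hν hpos hfin (hqx x), hx])
    (fun x x' => Sandwich.lintegral_orbitAverage_mul_orbitAverage hf hχ hν hpos hfin (hqx x)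
      (hqx x'))
    (fun heq => by
      obtain ⟨g, hg⟩ := hne
      exact hg (Sandwich.ae_condXY_smul_eq_of_jointRatio_eq hf hχ hν hpos hfin heq g))
  refine ⟨K, Ks, hf.isMarkovOperator ?_ hK, hf.isMarkovOperator ?_ hKs, h⟩
  · refine hf.ae_ae_lintegral_mul_condYX hf.measurable_condXY hq ?_
    filter_upwards [hf.ae_ae_margX_mul_jointRatio] with x hx
    refine (withDensity_absolutelyContinuous ν (Sandwich.margY μ f)).ae_le ?_
    filter_upwards [hx] with y hy using hy.symm
  · have hker : ∀ x' x, Sandwich.sandwichDensity μ ν f (Sandwich.orbitKernel μ f ω χ) x' x =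
        ∫⁻ y, Sandwich.orbitAverage ω χ (Sandwich.margY μ f) (Sandwich.condXY μ f x') y *
          Sandwich.condYX ν f y x ∂ν := fun x' x =>
      lintegral_congr fun y => congrArg (· * Sandwich.condYX ν f y x)
        (Sandwich.lintegral_orbitKernel hf hχ (hf.measurable_condXY.comp measurable_prodMk_left) y)
    simp_rw [hker]
    exact hf.ae_ae_lintegral_mul_condYX hRc hqs
      (Sandwich.ae_ae_orbitAverage_condXY hf hχ hν hpos hfin)
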